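/- Let $\mathbb{L}^3=(\mathbb{R}^3,\ dx_1^2+dx_2^2-dx_3^2)$ and let $\wedge$ be the Lorentzian exterior product, $\langle u\wedge v,w\rangle=\det(u,v,w)$. Let $M$ be a connected smooth surface without boundary, $S=\{q_1,\dots,q_n\}\subset M$ a finite set of $n$ distinct points, and $X:M\to\mathbb{L}^3$ a complete embedded maximal surface with special singularities at $q_1,\dots,q_n$ (equivalently, an entire maximal graph with these conelike singularities). That is: * $X$ is a topological embedding, and on $M\setminus S$ it is a smooth spacelike immersion with zero mean curvature; * each $q_i$ has an open neighbourhood $D$ such that $D\setminus\{q_i\}$, with the conformal structure of the induced metric, is an annulus $\{r<|z|<1\}$, $r>0$, with $|z|\to1$ corresponding to $q_i$, and the induced metric is $h(z)|dz|^2$ with $h\to0$ at $q_i$; * every divergent curve in $M$ has infinite length for the induced (singular) metric. Let $N$ be the unit normal of $X$ on $M\setminus S$ that points downwards (negative third coordinate), and orient $M\setminus S$ so that a tangent basis $(v,w)$ is positive if $\det(dX(v),dX(w),N)>0$. For an oriented smooth closed curve $\gamma:[0,L]\to M\setminus S$ parametrized by arc length, let $\nu$ be its unit conormal such that $(\nu,\gamma')$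 is positively oriented, and define its flux and torque by $$F(\gamma)=\int_0^L\nu(s)\,ds,\qquad T(\gamma)=\int_0^L X(\gamma(s))\wedge\nu(s)\,ds .$$ Let $B_1,\dots,B_n\subset M$ be pairwise disjoint smoothly embedded closed discs such that $B_i$ contains $q_i$ in its interior and no other singularity, and let $B_\infty\subset M$ be a smoothly embedded closed disc whose interior contains $B_1\cup\dots\cup B_n$. Let $\Omega=B_\infty\setminus\bigcup_i \operatorname{int}B_i$, a compact domain in $M\setminus S$. Let $\gamma_\infty,\gamma_1,\dots,\gamma_n$ be the boundary circles of $B_\infty,B_1,\dots,B_n$, each traversed once, parametrized by arc length and with the orientation induced by $\Omega$, so that the conormal $\nu$ above is the unit conormal exterior to $\Omega$. Write $F_\infty,F_i$ for the fluxes and $T_\infty,T_i$ for the torques along $\gamma_\infty,\gamma_i$. Then $$F_\infty+\sum_{i=1}^nF_i=0\qquad\text{and}\qquad T_\infty+\sum_{i=1}^nT_i=0 .$$ -/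

import Mathlib

open scoped Manifold ContDiff Topology ENNReal

noncomputable section

namespace MaximalSurface

/-! ### The Lorentz-Minkowski space -/

/-- The underlying vector space `ℝ³` of the Lorentz-Minkowski space `𝕃³`. -/
abbrev L3 : Type := Fin 3 → ℝ

/-- The coordinate plane on which the surfaces are modelled. -/
abbrev E2 : Type := EuclideanSpace ℝ (Fin 2)

/-- The standard basis of `ℝ²`. -/
def stdVec (i : Fin 2) : E2 := EuclideanSpace.single i (1 : ℝ)

/-- The Lorentzian metric `dx₁² + dx₂² - dx₃²`. -/
def lorentz (v w : L3) : ℝ := v 0 * w 0 + v 1 * w 1 - v 2 * w 2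

/-- The Lorentzian exterior product `u ∧ v`, characterized by `⟨u ∧ v, w⟩ = det (u, v, w)`
(see `lorentz_wedge`). -/
def wedge (u v : L3) : L3 :=
  ![u 1 * v 2 - u 2 * v 1, u 2 * v 0 - u 0 * v 2, -(u 0 * v 1 - u 1 * v 0)]

theorem lorentz_wedge (u v w : L3) :
    lorentz (wedge u v) w = Matrix.det (Matrix.of ![u, v, w]) := by
  simp [lorentz, wedge, Matrix.det_fin_three]
  ring

section Surface

variable {M : Type*} [TopologicalSpace M] [ChartedSpace E2 M]

/-! ### Spacelike immersions, Gauss map, mean curvature -/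

/-- The differential `dX_p(v)` of `X` at `p`. -/
def diffl (X : M → L3) (p : M) (v : TangentSpace (𝓡 2) p) : L3 :=
  mfderiv (𝓡 2) 𝓘(ℝ, L3) X p v

/-- `X` is a spacelike immersion at `p`: the induced quadratic form on `T_pM` is positive
definite (in particular the differential is injective). -/
def SpacelikeAt (X : M → L3) (p : M) : Prop :=
  ∀ v : TangentSpace (𝓡 2) p, v ≠ 0 → 0 < lorentz (diffl X p v) (diffl X p v)

/-- A (timelike, not normalized) normal vector of `X` at `p`. -/
def rawNormal (X : M → L3) (p : M) : L3 :=
  wedge (diffl X p (stdVec 0)) (diffl X p (stdVec 1))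

/-- The Gauss map of a spacelike immersion, in the orientation for which the normal points
downwards: the unit timelike normal with negative third coordinate (see `gaussMap_spec`). -/
def gaussMap (X : M → L3) (p : M) : L3 :=
  (-(SignType.sign (rawNormal X p 2) : ℝ) / √(-lorentz (rawNormal X p) (rawNormal X p))) •
    rawNormal X p

theorem gaussMap_spec {X : M → L3} {p : M} (hX : SpacelikeAt X p) :
    lorentz (gaussMap X p) (gaussMap X p) = -1 ∧ gaussMap X p 2 < 0 ∧
      ∀ v, lorentz (diffl X p v) (gaussMap X p) = 0 := by
  set a := diffl X p (stdVec 0) with ha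
  set b := diffl X p (stdVec 1) with hb
  have hlin : ∀ s t : ℝ, diffl X p (s • stdVec 0 + t • stdVec 1 : E2) = s • a + t • b := by
    intro s t
    have h := (mfderiv (𝓡 2) 𝓘(ℝ, L3) X p).map_add (s • stdVec 0 : E2) (t • stdVec 1 : E2)
    have h1 := (mfderiv (𝓡 2) 𝓘(ℝ, L3) X p).map_smul s (stdVec 0)
    have h2 := (mfderiv (𝓡 2) 𝓘(ℝ, L3) X p).map_smul t (stdVec 1)
    exact h.trans (congrArg₂ (· + ·) h1 h2)
  have hb0 : 0 < lorentz b b := hX (stdVec 1) (fun h => by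
    have h' := congrArg (fun w : E2 => w 1) (show (stdVec 1 : E2) = (0 : E2) from h)
    simp [stdVec] at h')
  have hdet : 0 < lorentz a a * lorentz b b - lorentz a b ^ 2 := by
    have h := hX (lorentz b b • stdVec 0 + (-lorentz a b) • stdVec 1 : E2) (fun h => by
      have h' := congrArg (fun w : E2 => w 0) (show
        (lorentz b b • stdVec 0 + (-lorentz a b) • stdVec 1 : E2) = (0 : E2) from h)
      simp [stdVec] at h'
      exact hb0.ne' h')
    rw [hlin] at h
    have e : lorentz (lorentz b b • a + (-lorentz a b) • b) (lorentz b b • a + (-lorentz a b) • b)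
        = lorentz b b * (lorentz a a * lorentz b b - lorentz a b ^ 2) := by
      simp only [lorentz, Pi.add_apply, Pi.smul_apply, smul_eq_mul]
      ring
    rw [e] at h
    exact pos_of_mul_pos_right h hb0.le
  have hn : rawNormal X p = wedge a b := rfl
  set m := rawNormal X p with hm
  have hmm : -lorentz m m = lorentz a a * lorentz b b - lorentz a b ^ 2 := by
    rw [hn]
    simp [lorentz, wedge]
    ring
  have hpos : 0 < -lorentz m m := hmm ▸ hdet
  have hm2 : m 2 ≠ 0 := by
    intro h
    have : lorentz m m = m 0 ^ 2 + m 1 ^ 2 := by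
      simp only [lorentz, h]
      ring
    nlinarith [sq_nonneg (m 0), sq_nonneg (m 1)]
  have hsq : √(-lorentz m m) ^ 2 = -lorentz m m := Real.sq_sqrt hpos.le
  have hs : 0 < √(-lorentz m m) := Real.sqrt_pos.2 hpos
  set k : ℝ := -(SignType.sign (m 2) : ℝ) / √(-lorentz m m) with hk
  have hN : gaussMap X p = k • m := rfl
  rw [hN]
  refine ⟨?_, ?_, fun v => ?_⟩
  · have e : lorentz (k • m) (k • m) = k ^ 2 * lorentz m m := by
      simp only [lorentz, Pi.smul_apply, smul_eq_mul]
      ring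
    have hk2 : k ^ 2 = 1 / (-lorentz m m) := by
      rw [hk, div_pow, hsq]
      rcases lt_or_gt_of_ne hm2 with h | h
      · simp [sign_neg h]
      · simp [sign_pos h]
    rw [e, hk2]
    have := hpos.ne'
    rw [div_mul_eq_mul_div, one_mul, div_neg, div_self (by simpa using this)]
  · simp only [Pi.smul_apply, smul_eq_mul, hk]
    rcases lt_or_gt_of_ne hm2 with h | h
    · rw [sign_neg h]
      simpa using mul_neg_of_pos_of_neg (inv_pos.2 hs) h
    · rw [sign_pos h]
      have := mul_pos (inv_pos.2 hs) h
      simp only [SignType.coe_one, neg_div, one_div, neg_mul]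
      linarith
  · have hv : ∀ w : E2, w = w 0 • stdVec 0 + w 1 • stdVec 1 := by
      intro w
      ext i
      fin_cases i <;> simp [stdVec]
    have hv' : diffl X p v = _ := (congrArg (diffl X p) (hv v)).trans (hlin _ _)
    rw [hv', hn]
    simp [lorentz, wedge]
    ring

/-- The mean curvature of `X` at `p`, i.e. half of the trace of the second fundamental form with
respect to the first one, computed in the chart of `M` at `p`. -/
def meanCurvature (X : M → L3) (p : M) : ℝ :=
  let Y : E2 → L3 := X ∘ (extChartAt (𝓡 2) p).symm
  let x : E2 := extChartAt (𝓡 2) p p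
  let g : Fin 2 → Fin 2 → ℝ := fun i j =>
    lorentz (fderiv ℝ Y x (stdVec i)) (fderiv ℝ Y x (stdVec j))
  let h : Fin 2 → Fin 2 → ℝ := fun i j =>
    lorentz (fderiv ℝ (fun y => fderiv ℝ Y y (stdVec j)) x (stdVec i)) (gaussMap X p)
  (g 1 1 * h 0 0 - 2 * g 0 1 * h 0 1 + g 0 0 * h 1 1) / (2 * (g 0 0 * g 1 1 - g 0 1 ^ 2))

/-- `X` restricted to the (open) set `U` is a maximal immersion: a smooth spacelike immersion
with vanishing mean curvature. -/
structure IsMaximalImmersionOn (X : M → L3) (U : Set M) : Prop where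
  smooth : ContMDiffOn (𝓡 2) 𝓘(ℝ, L3) ∞ X U
  spacelike : ∀ p ∈ U, SpacelikeAt X p
  maximal : ∀ p ∈ U, meanCurvature X p = 0

/-! ### Special singularities, completeness, CMF graphs -/

/-- The point `q` is a special singularity of `X`: it has an open neighbourhood `D` such that
`D \ {q}`, with the conformal structure of the induced metric, is an annulus `r < |z| < 1` with
`r > 0` (the map `Z` below is the inverse of the conformal parameter `z`, and `|z| → 1`
corresponds to `q`), and, writing the induced metric as `h(z)|dz|²`, the conformal factor `h`
tends to `0` at `q`. -/
def IsSpecialSingularity (X : M → L3) (q : M) : Prop :=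
  ∃ (D : Set M) (r : ℝ) (Z : ℂ → M) (h : ℂ → ℝ),
    IsOpen D ∧ q ∈ D ∧ 0 < r ∧ r < 1 ∧
    ContMDiffOn 𝓘(ℝ, ℂ) (𝓡 2) ∞ Z {z | r < ‖z‖ ∧ ‖z‖ < 1} ∧
    Set.BijOn Z {z | r < ‖z‖ ∧ ‖z‖ < 1} (D \ {q}) ∧
    Filter.Tendsto Z (Filter.comap (fun z : ℂ => ‖z‖) (𝓝[<] 1)) (𝓝 q) ∧
    (∀ z : ℂ, r < ‖z‖ → ‖z‖ < 1 → 0 < h z ∧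
      ∀ w : ℂ, lorentz (diffl X (Z z) (mfderiv 𝓘(ℝ, ℂ) (𝓡 2) Z z w))
        (diffl X (Z z) (mfderiv 𝓘(ℝ, ℂ) (𝓡 2) Z z w)) = h z * ‖w‖ ^ 2) ∧
    Filter.Tendsto h (Filter.comap (fun z : ℂ => ‖z‖) (𝓝[<] 1)) (𝓝 0)

/-- The velocity `γ'(s)` of a curve in `M`. -/
def velocity (γ : ℝ → M) (s : ℝ) : TangentSpace (𝓡 2) (γ s) :=
  mfderiv 𝓘(ℝ, ℝ) (𝓡 2) γ s (1 : ℝ)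

/-- The length of the curve `α : [0, ∞) → M` for the metric induced by `X`, which degenerates
at the points of `F`. -/
def inducedLength (X : M → L3) (F : Set M) (α : ℝ → M) : ℝ≥0∞ :=
  ∫⁻ t in Set.Ioi (0 : ℝ) ∩ α ⁻¹' Fᶜ, ENNReal.ofReal
    (√(lorentz (diffl X (α t) (velocity α t)) (diffl X (α t) (velocity α t))))

/-- Every divergent curve in `M` has infinite length for the induced (singular) metric. Curves
may have zero velocity, so piecewise `C¹` curves are covered after a reparametrization. -/
def IsCompleteMetric (X : M → L3) (F : Set M) : Prop :=
  ∀ α : ℝ → M, ContMDiff 𝓘(ℝ, ℝ) (𝓡 2) 1 α →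
    Filter.Tendsto α Filter.atTop (Filter.cocompact M) → inducedLength X F α = ⊤

/-- `X : M → 𝕃³` is a complete embedded maximal surface (equivalently, an entire maximal graph)
with singular set `F`, where all points of `F` are special singularities. -/
structure IsCMFGraph (X : M → L3) (F : Set M) : Prop where
  finite : F.Finite
  isMaximalImmersionOn : IsMaximalImmersionOn X Fᶜ
  singular : ∀ q ∈ F, IsSpecialSingularity X q
  complete : IsCompleteMetric X F
  isEmbedding : Topology.IsEmbedding X

/-! ### Conormal, flux and torque -/

/-- The unit conormal at `p` to a curve with unit velocity `τ ∈ T_pM`, as a vector of `𝕃³`: the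
unit vector `ν` in the tangent plane which is orthogonal to `τ` and such that `(ν, τ)` is
positively oriented, i.e. `det (ν, τ, N) > 0` for the Gauss map `N`
(see `conormal_spec`). -/
def conormal (X : M → L3) (p : M) (τ : TangentSpace (𝓡 2) p) : L3 :=
  wedge (diffl X p τ) (gaussMap X p)

theorem conormal_spec {X : M → L3} {p : M} (hX : SpacelikeAt X p) (τ : TangentSpace (𝓡 2) p)
    (hτ : lorentz (diffl X p τ) (diffl X p τ) = 1) :
    (∃ v : TangentSpace (𝓡 2) p, diffl X p v = conormal X p τ) ∧
      lorentz (conormal X p τ) (conormal X p τ) = 1 ∧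
      lorentz (conormal X p τ) (diffl X p τ) = 0 ∧
      0 < Matrix.det (Matrix.of ![conormal X p τ, diffl X p τ, gaussMap X p]) := by
  obtain ⟨h1, -, h3⟩ := gaussMap_spec hX
  have hc : lorentz (conormal X p τ) (conormal X p τ) = 1 := by
    have e : lorentz (conormal X p τ) (conormal X p τ) =
        lorentz (diffl X p τ) (gaussMap X p) ^ 2 -
          lorentz (diffl X p τ) (diffl X p τ) * lorentz (gaussMap X p) (gaussMap X p) := by
      simp [conormal, lorentz, wedge]
      ring
    rw [e, h3, h1, hτ]
    norm_num
  refine ⟨?_, hc, ?_, ?_⟩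
  · set a := diffl X p (stdVec 0) with ha
    set b := diffl X p (stdVec 1) with hb
    set t := diffl X p τ with ht
    obtain ⟨k, hk⟩ : ∃ k : ℝ, gaussMap X p = k • wedge a b := ⟨_, rfl⟩
    refine ⟨(show E2 from ((-(k * lorentz t b)) • stdVec 0 + (k * lorentz t a) • stdVec 1)), ?_⟩
    have h := (mfderiv (𝓡 2) 𝓘(ℝ, L3) X p).map_add ((-(k * lorentz t b)) • stdVec 0 : E2)
      ((k * lorentz t a) • stdVec 1 : E2)
    have h1 := (mfderiv (𝓡 2) 𝓘(ℝ, L3) X p).map_smul (-(k * lorentz t b)) (stdVec 0)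
    have h2 := (mfderiv (𝓡 2) 𝓘(ℝ, L3) X p).map_smul (k * lorentz t a) (stdVec 1)
    refine (h.trans (congrArg₂ (· + ·) h1 h2)).trans ?_
    change (-(k * lorentz t b)) • a + (k * lorentz t a) • b = wedge t (gaussMap X p)
    rw [hk]
    ext i
    fin_cases i <;> simp [lorentz, wedge] <;> ring
  · simp [conormal, lorentz, wedge]
    ring
  · have e : Matrix.det (Matrix.of ![conormal X p τ, diffl X p τ, gaussMap X p]) =
        lorentz (conormal X p τ) (conormal X p τ) := by
      simp [conormal, lorentz, wedge, Matrix.det_fin_three]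
      ring
    rw [e, hc]
    exact one_pos

/-- `γ` is an (`L`-periodic) smooth closed curve of length `L` in `M`, parametrized by arc length
for the metric induced by `X`. -/
structure IsArclengthLoop (X : M → L3) (γ : ℝ → M) (L : ℝ) : Prop where
  pos : 0 < L
  smooth : ContMDiff 𝓘(ℝ, ℝ) (𝓡 2) ∞ γ
  periodic : Function.Periodic γ L
  arclength : ∀ s, lorentz (diffl X (γ s) (velocity γ s)) (diffl X (γ s) (velocity γ s)) = 1

/-- The flux `∫_γ ν ds` of `X` along the closed curve `γ`, parametrized by arc length on
`[0, L]`. -/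
def flux (X : M → L3) (γ : ℝ → M) (L : ℝ) : L3 :=
  ∫ s in (0 : ℝ)..L, conormal X (γ s) (velocity γ s)

/-- The torque `∫_γ X ∧ ν ds` of `X` along the closed curve `γ`, parametrized by arc length on
`[0, L]`. -/
def torque (X : M → L3) (γ : ℝ → M) (L : ℝ) : L3 :=
  ∫ s in (0 : ℝ)..L, wedge (X (γ s)) (conormal X (γ s) (velocity γ s))

/-! ### Discs and domains -/

variable (M) in
/-- A smoothly embedded closed disc in `M`, given by an injective smooth immersion of (a
neighbourhood of) the closed unit disc. -/
structure ClosedDisc where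
  toFun : ℂ → M
  smooth : ∃ U : Set ℂ, IsOpen U ∧ Metric.closedBall 0 1 ⊆ U ∧
    ContMDiffOn 𝓘(ℝ, ℂ) (𝓡 2) ∞ toFun U
  injOn : Set.InjOn toFun (Metric.closedBall 0 1)
  immersion : ∀ z ∈ Metric.closedBall (0 : ℂ) 1,
    Function.Injective (mfderiv 𝓘(ℝ, ℂ) (𝓡 2) toFun z)

/-- The closed disc as a subset of `M`. -/
def ClosedDisc.carrier (B : ClosedDisc M) : Set M := B.toFun '' Metric.closedBall 0 1

/-- The interior of the closed disc. -/
def ClosedDisc.inner (B : ClosedDisc M) : Set M := B.toFun '' Metric.ball 0 1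

/-- The boundary circle of the closed disc. -/
def ClosedDisc.bdry (B : ClosedDisc M) : Set M := B.toFun '' Metric.sphere 0 1

/-- The tangent vector `v` at the boundary point `p` of a domain `Ω` points out of `Ω` (in the
chart of `M` at `p`, with which Mathlib identifies `T_pM` and `ℝ²`). -/
def PointsOutOf (Ω : Set M) (p : M) (v : TangentSpace (𝓡 2) p) : Prop :=
  ∀ᶠ t : ℝ in 𝓝[>] 0,
    (extChartAt (𝓡 2) p).symm (extChartAt (𝓡 2) p p + t • (show E2 from v)) ∉ Ω

/-- `γ : [0, L] → M` is a parametrization by arc length of the boundary circle of the disc `B`,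
traversed once, with the orientation induced by the domain `Ω`: the conormal `ν` for which
`(ν, γ')` is positively oriented is the exterior one. -/
structure IsOrientedBoundaryCurve (X : M → L3) (Ω : Set M) (B : ClosedDisc M)
    (γ : ℝ → M) (L : ℝ) : Prop where
  isArclengthLoop : IsArclengthLoop X γ L
  simple : Set.InjOn γ (Set.Ico 0 L)
  range_eq : Set.range γ = B.bdry
  exterior : ∀ s, ∃ v : TangentSpace (𝓡 2) (γ s),
    diffl X (γ s) v = conormal X (γ s) (velocity γ s) ∧ PointsOutOf Ω (γ s) v

/-- The closed discs `Binf`, `B 0, …, B (n - 1)` are as in the definition of the fluxes at the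
singularities `q i` and at the end: `B i` contains `q i` in its interior and no other singularity,
and the discs `B i` are pairwise disjoint and contained in the interior of `Binf`. -/
structure AreSeparatingDiscs {n : ℕ} (q : Fin n → M) (Binf : ClosedDisc M)
    (B : Fin n → ClosedDisc M) : Prop where
  mem_inner : ∀ i, q i ∈ (B i).inner
  notMem : ∀ i j, j ≠ i → q j ∉ (B i).carrier
  disjoint : ∀ i j, i ≠ j → Disjoint (B i).carrier (B j).carrier
  subset : ∀ i, (B i).carrier ⊆ Binf.inner

/-- The compact domain `Ω ⊆ M \ {q i}` bounded by the boundary circles of the discs `Binf` and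
`B i`. -/
def holedDisc {n : ℕ} (Binf : ClosedDisc M) (B : Fin n → ClosedDisc M) : Set M :=
  Binf.carrier \ ⋃ i, (B i).inner

end Surface

end MaximalSurface

end

/-!
Let `N` be the Gauss map. The `𝕃³`-valued one-forms `dX ∧ N` and `X ∧ (dX ∧ N)` are smooth off the
singularities, and since the conormal of an arclength curve is `dX(γ') ∧ N`, the flux and the torque
are their integrals along curves. Both forms are closed: the exterior derivative of `dX ∧ N` is the
trace of the shape operator times `dX(e₁) ∧ dX(e₂)`, so it vanishes with the mean curvature
(`closedFormAt_fluxField`), and the one of `X ∧ (dX ∧ N)` has the additional term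
`(dX(e₁) ∧ dX(e₂)) ∧ N = 0` by the Jacobi identity (`closedFormAt_torqueField`). The balance
formulas are therefore Stokes' theorem on the domain between the discs (`integral_balance`).

Stokes' theorem for such a domain is reduced to the unit disc. Take a function `ρ` supported in the
inner discs and equal to `1` near the singularities. For each of the discs, with parametrization
`f`, the form `(1 - ρ) f^*ω` is smooth on the whole parameter disc, so that Stokes' theorem there
(`circleInt_eq_integral_ball`, proved in polar coordinates) gives
`∫_{|z| = 1} f^*ω = -∫_{|z| < 1} f^*(dρ ∧ ω)`. For the outer disc the integrand lives on the inner
discs, and the change of variables by the transition maps turns the right-hand side into the sum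
of those of the inner discs (`circleInt_balance`).

It remains to compare orientations. The area form `det(dX ·, dX ·, N)` has a constant sign `τ` in
each parametrization, because a disc without finitely many points is connected
(`ClosedDisc.exists_sign_signedJacobian`). A simple closed arclength curve runs once through the
parameter circle (`integral_simple_loop`), and as its conormal points out of the domain, its
direction is given by `τ` for the outer disc and by `-τ` for the inner ones
(`IsOrientedBoundaryCurve.integral_eq_sign`).
-/

noncomputable section

namespace MaximalSurface

/-! ### Algebra of the Lorentzian exterior product -/

theorem lorentz_wedge_self (a b : L3) :
    -lorentz (wedge a b) (wedge a b) = lorentz a a * lorentz b b - lorentz a b ^ 2 := by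
  simp [lorentz, wedge]
  ring

theorem lorentz_smul_smul (k : ℝ) (m : L3) : lorentz (k • m) (k • m) = k ^ 2 * lorentz m m := by
  simp only [lorentz, Pi.smul_apply, smul_eq_mul]
  ring

/-- Expansion of a vector in the basis `a`, `b`, `a ∧ b`. -/
theorem gram_smul_eq (a b v : L3) :
    (lorentz a a * lorentz b b - lorentz a b ^ 2) • v =
      (lorentz v a * lorentz b b - lorentz v b * lorentz a b) • a +
      (lorentz v b * lorentz a a - lorentz v a * lorentz a b) • b -
      lorentz v (wedge a b) • wedge a b := by
  ext i
  fin_cases i <;> simp [lorentz, wedge] <;> ring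

theorem apply_two_ne_zero_of_timelike {m : L3} (h : lorentz m m < 0) : m 2 ≠ 0 := by
  intro h2
  have : lorentz m m = m 0 ^ 2 + m 1 ^ 2 := by
    simp only [lorentz, h2]
    ring
  nlinarith [sq_nonneg (m 0), sq_nonneg (m 1)]

/-- The exterior product as a bilinear map. -/
def wedgeLin : L3 →ₗ[ℝ] L3 →ₗ[ℝ] L3 :=
  LinearMap.mk₂ ℝ wedge
    (fun a b c => by ext i; fin_cases i <;> simp [wedge] <;> ring)
    (fun k a b => by ext i; fin_cases i <;> simp [wedge] <;> ring)
    (fun a b c => by ext i; fin_cases i <;> simp [wedge] <;> ring)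
    (fun k a b => by ext i; fin_cases i <;> simp [wedge] <;> ring)

/-- The exterior product as a continuous bilinear map. -/
def wedgeCLM : L3 →L[ℝ] L3 →L[ℝ] L3 := LinearMap.toContinuousBilinearMap wedgeLin

@[simp] theorem wedgeCLM_apply (a b : L3) : wedgeCLM a b = wedge a b := rfl

theorem wedge_add_smul (a b : L3) (s t s' t' : ℝ) :
    wedge (s • a + t • b) (s' • a + t' • b) = (s * t' - t * s') • wedge a b := by
  ext i
  fin_cases i <;> simp [wedge] <;> ring

theorem wedge_self (a : L3) : wedge a a = 0 := by
  ext i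
  fin_cases i <;> simp [wedge] <;> ring

theorem wedge_swap (a b : L3) : wedge a b = -wedge b a := by
  ext i
  fin_cases i <;> simp [wedge] <;> ring

/-- The Jacobi identity: `𝕃³` with the exterior product is a Lie algebra. -/
theorem wedge_jacobi (a b c : L3) :
    wedge a (wedge b c) - wedge b (wedge a c) = wedge (wedge a b) c := by
  ext i
  fin_cases i <;> simp [wedge] <;> ring

/-- The downward unit vector in the direction of the timelike vector `m`. -/
def downUnit (m : L3) : L3 := (-(SignType.sign (m 2) : ℝ) / √(-lorentz m m)) • m

theorem downUnit_smul {k : ℝ} (hk : k ≠ 0) (m : L3) : downUnit (k • m) = downUnit m := by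
  have h1 : √(-lorentz (k • m) (k • m)) = |k| * √(-lorentz m m) := by
    rw [lorentz_smul_smul, ← mul_neg, Real.sqrt_mul (sq_nonneg k), Real.sqrt_sq_eq_abs]
  have h3 : |k| ≠ 0 := abs_ne_zero.2 hk
  have h2 : (SignType.sign ((k • m) 2) : ℝ) * k = |k| * SignType.sign (m 2) := by
    rw [Pi.smul_apply, smul_eq_mul, sign_mul, SignType.coe_mul, mul_right_comm, sign_mul_self]
  rw [downUnit, downUnit, h1, smul_smul]
  congr 1
  rw [div_mul_eq_mul_div, neg_mul, h2, ← mul_neg, mul_div_mul_left _ _ h3]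

theorem downUnit_eq_self {m : L3} (h : lorentz m m = -1) (h2 : m 2 < 0) : downUnit m = m := by
  simp [downUnit, h, sign_neg h2]

theorem contDiffAt_downUnit {m : L3} (h : lorentz m m < 0) : ContDiffAt ℝ ∞ downUnit m := by
  have hc : ∀ i : Fin 3, ContDiff ℝ ∞ (fun m : L3 => m i) := fun i => contDiff_apply ℝ ℝ i
  have hl : ContDiff ℝ ∞ (fun m : L3 => lorentz m m) :=
    (((hc 0).mul (hc 0)).add ((hc 1).mul (hc 1))).sub ((hc 2).mul (hc 2))
  have key : ∀ σ : ℝ, ContDiffAt ℝ ∞ (fun m' : L3 => (-σ / √(-lorentz m' m')) • m') m := by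
    intro σ
    have hs : ContDiffAt ℝ ∞ (fun m' : L3 => √(-lorentz m' m')) m :=
      (hl.neg.contDiffAt).sqrt (by linarith)
    have hd : ContDiffAt ℝ ∞ (fun m' : L3 => -σ / √(-lorentz m' m')) m :=
      contDiffAt_const.div hs (Real.sqrt_pos.2 (by linarith)).ne'
    exact hd.smul contDiffAt_id
  refine (key (SignType.sign (m 2))).congr_of_eventuallyEq ?_
  have hs : ∀ᶠ m' : L3 in 𝓝 m, SignType.sign (m' 2) = SignType.sign (m 2) := by
    rcases lt_or_gt_of_ne (apply_two_ne_zero_of_timelike h) with h' | h'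
    · filter_upwards [(continuous_apply (2 : Fin 3)).continuousAt.eventually_lt_const h'] with y hy
      rw [sign_neg hy, sign_neg h']
    · filter_upwards [(continuous_apply (2 : Fin 3)).continuousAt.eventually_const_lt h'] with y hy
      rw [sign_pos hy, sign_pos h']
  filter_upwards [hs] with y hy
  rw [downUnit, hy]

/-- A downward unit vector orthogonal to a spacelike plane is determined by a basis of it. -/
theorem eq_downUnit_wedge {a b N : L3} (hg : 0 < lorentz a a * lorentz b b - lorentz a b ^ 2)
    (h1 : lorentz N N = -1) (h2 : N 2 < 0) (ha : lorentz a N = 0) (hb : lorentz b N = 0) :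
    N = downUnit (wedge a b) := by
  have e := gram_smul_eq a b N
  have ha' : lorentz N a = 0 := by rw [← ha]; simp only [lorentz]; ring
  have hb' : lorentz N b = 0 := by rw [← hb]; simp only [lorentz]; ring
  rw [ha', hb'] at e
  set g := lorentz a a * lorentz b b - lorentz a b ^ 2
  set c := lorentz N (wedge a b)
  have e' : N = (-(c / g)) • wedge a b := by
    have : N = g⁻¹ • (g • N) := by rw [smul_smul, inv_mul_cancel₀ hg.ne', one_smul]
    rw [this, e]
    simp only [zero_mul, sub_zero, zero_smul, add_zero, zero_sub, smul_neg, smul_smul, neg_smul]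
    rw [div_eq_inv_mul]
  have hk : -(c / g) ≠ 0 := by
    intro h
    rw [h, zero_smul] at e'
    rw [e'] at h2
    simp at h2
  conv_lhs => rw [← downUnit_eq_self h1 h2, e', downUnit_smul hk]

/-- If `N₁` and `N₂` are the derivatives of the unit normal `N` of a surface with tangent basis
`Y₁`, `Y₂` and vanishing mean curvature, then `Y₁ ∧ N₂ = Y₂ ∧ N₁`: both shape operator
coefficients on the diagonal contribute `Y₁ ∧ Y₂`, and their sum is the trace. -/
theorem wedge_shape_symm {Y1 Y2 N N1 N2 : L3} {h11 h12 h22 : ℝ}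
    (hg : 0 < lorentz Y1 Y1 * lorentz Y2 Y2 - lorentz Y1 Y2 ^ 2)
    (hN : N = downUnit (wedge Y1 Y2))
    (hN1 : lorentz N1 N = 0) (hN2 : lorentz N2 N = 0)
    (h11' : lorentz N1 Y1 = -h11) (h12' : lorentz N1 Y2 = -h12) (h21' : lorentz N2 Y1 = -h12)
    (h22' : lorentz N2 Y2 = -h22)
    (hH : lorentz Y2 Y2 * h11 - 2 * lorentz Y1 Y2 * h12 + lorentz Y1 Y1 * h22 = 0) :
    wedge Y1 N2 = wedge Y2 N1 := by
  set g := lorentz Y1 Y1 * lorentz Y2 Y2 - lorentz Y1 Y2 ^ 2 with hgd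
  have hm : lorentz (wedge Y1 Y2) (wedge Y1 Y2) < 0 := by
    have := lorentz_wedge_self Y1 Y2
    linarith
  have hk : ∃ k : ℝ, k ≠ 0 ∧ N = k • wedge Y1 Y2 := by
    refine ⟨_, ?_, hN⟩
    refine div_ne_zero (neg_ne_zero.2 ?_) (Real.sqrt_pos.2 (by linarith)).ne'
    rcases lt_or_gt_of_ne (apply_two_ne_zero_of_timelike hm) with h' | h'
    · simp [sign_neg h']
    · simp [sign_pos h']
  obtain ⟨k, hk, hNk⟩ := hk
  have hperp : ∀ v, lorentz v N = 0 → lorentz v (wedge Y1 Y2) = 0 := by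
    intro v hv
    have : lorentz v N = k * lorentz v (wedge Y1 Y2) := by
      rw [hNk]; simp only [lorentz, Pi.smul_apply, smul_eq_mul]; ring
    rw [this] at hv
    exact (mul_eq_zero.1 hv).resolve_left hk
  have e1 := gram_smul_eq Y1 Y2 N1
  have e2 := gram_smul_eq Y1 Y2 N2
  rw [hperp _ hN1, zero_smul, sub_zero, h11', h12', ← hgd] at e1
  rw [hperp _ hN2, zero_smul, sub_zero, h21', h22', ← hgd] at e2
  have hY : g • wedge Y1 N2 = g • wedge Y2 N1 := by
    have l1 : g • wedge Y1 N2 = wedgeCLM Y1 (g • N2) := by simp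
    have l2 : g • wedge Y2 N1 = wedgeCLM Y2 (g • N1) := by simp
    rw [l1, l2, e1, e2]
    simp only [map_add, map_smul, wedgeCLM_apply, wedge_self, smul_zero, zero_add, add_zero]
    rw [wedge_swap Y2 Y1, smul_neg, ← neg_smul]
    congr 1
    linarith
  exact smul_right_injective _ hg.ne' hY

/-! ### The Gauss map in a parametrization -/

section Surface

variable {M : Type*} [TopologicalSpace M] [ChartedSpace E2 M]
variable {E : Type*} [NormedAddCommGroup E] [NormedSpace ℝ E]

theorem fderiv_comp_eq_diffl {X : M → L3} {f : E → M} {z : E}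
    (hX : MDifferentiableAt (𝓡 2) 𝓘(ℝ, L3) X (f z))
    (hf : MDifferentiableAt 𝓘(ℝ, E) (𝓡 2) f z) (v : E) :
    fderiv ℝ (X ∘ f) z v = diffl X (f z) (mfderiv 𝓘(ℝ, E) (𝓡 2) f z v) := by
  have h := mfderiv_comp z hX hf
  rw [mfderiv_eq_fderiv] at h
  rw [h]
  rfl

theorem diffl_lin (X : M → L3) (p : M) (s t : ℝ) (u v : TangentSpace (𝓡 2) p) :
    diffl X p (s • u + t • v) = s • diffl X p u + t • diffl X p v := by
  have h := (mfderiv (𝓡 2) 𝓘(ℝ, L3) X p).map_add (s • u) (t • v)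
  have h1 := (mfderiv (𝓡 2) 𝓘(ℝ, L3) X p).map_smul s u
  have h2 := (mfderiv (𝓡 2) 𝓘(ℝ, L3) X p).map_smul t v
  exact h.trans (congrArg₂ (· + ·) h1 h2)

theorem SpacelikeAt.gram_pos {X : M → L3} {p : M} (hX : SpacelikeAt X p)
    {u v : TangentSpace (𝓡 2) p} (huv : ∀ s t : ℝ, s • u + t • v = 0 → s = 0 ∧ t = 0) :
    0 < lorentz (diffl X p u) (diffl X p u) * lorentz (diffl X p v) (diffl X p v) -
      lorentz (diffl X p u) (diffl X p v) ^ 2 := by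
  set a := diffl X p u with ha
  set b := diffl X p v with hb
  have hb0 : 0 < lorentz b b := hX v (fun h => by
    have := (huv 0 1 (by rw [h, smul_zero, zero_smul, add_zero])).2
    exact one_ne_zero this)
  have h := hX (lorentz b b • u + (-lorentz a b) • v) (fun h => hb0.ne' (huv _ _ h).1)
  rw [diffl_lin, ← ha, ← hb] at h
  have e : lorentz (lorentz b b • a + (-lorentz a b) • b) (lorentz b b • a + (-lorentz a b) • b)
      = lorentz b b * (lorentz a a * lorentz b b - lorentz a b ^ 2) := by
    simp only [lorentz, Pi.add_apply, Pi.smul_apply, smul_eq_mul]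
    ring
  rw [e] at h
  exact pos_of_mul_pos_right h hb0.le

section Param

variable {X : M → L3} {f : E → M} {z : E} {e₁ e₂ : E}

/-- The Gram determinant of a parametrization of a spacelike surface is positive. -/
theorem gram_fderiv_pos (hX : MDifferentiableAt (𝓡 2) 𝓘(ℝ, L3) X (f z))
    (hs : SpacelikeAt X (f z)) (hf : MDifferentiableAt 𝓘(ℝ, E) (𝓡 2) f z)
    (hinj : Function.Injective (mfderiv 𝓘(ℝ, E) (𝓡 2) f z))
    (he : ∀ s t : ℝ, s • e₁ + t • e₂ = 0 → s = 0 ∧ t = 0) :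
    0 < lorentz (fderiv ℝ (X ∘ f) z e₁) (fderiv ℝ (X ∘ f) z e₁) *
        lorentz (fderiv ℝ (X ∘ f) z e₂) (fderiv ℝ (X ∘ f) z e₂) -
      lorentz (fderiv ℝ (X ∘ f) z e₁) (fderiv ℝ (X ∘ f) z e₂) ^ 2 := by
  simp only [fderiv_comp_eq_diffl hX hf]
  refine hs.gram_pos fun s t h => he s t (hinj ?_)
  have h0 := (mfderiv 𝓘(ℝ, E) (𝓡 2) f z).map_zero
  have h1 := (mfderiv 𝓘(ℝ, E) (𝓡 2) f z).map_add (s • e₁ : E) (t • e₂ : E)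
  have h2 := (mfderiv 𝓘(ℝ, E) (𝓡 2) f z).map_smul s e₁
  have h3 := (mfderiv 𝓘(ℝ, E) (𝓡 2) f z).map_smul t e₂
  exact (h1.trans (congrArg₂ (· + ·) h2 h3)).trans (h.trans h0.symm)

/-- The Gauss map in an arbitrary parametrization. -/
theorem gaussMap_comp_eq (hX : MDifferentiableAt (𝓡 2) 𝓘(ℝ, L3) X (f z))
    (hs : SpacelikeAt X (f z)) (hf : MDifferentiableAt 𝓘(ℝ, E) (𝓡 2) f z)
    (hinj : Function.Injective (mfderiv 𝓘(ℝ, E) (𝓡 2) f z))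
    (he : ∀ s t : ℝ, s • e₁ + t • e₂ = 0 → s = 0 ∧ t = 0) :
    gaussMap X (f z) =
      downUnit (wedge (fderiv ℝ (X ∘ f) z e₁) (fderiv ℝ (X ∘ f) z e₂)) := by
  obtain ⟨h1, h2, h3⟩ := gaussMap_spec hs
  refine eq_downUnit_wedge (gram_fderiv_pos hX hs hf hinj he) h1 h2 ?_ ?_
  · rw [fderiv_comp_eq_diffl hX hf]; exact h3 _
  · rw [fderiv_comp_eq_diffl hX hf]; exact h3 _

/-- The Gauss map is smooth in every regular parametrization. -/
theorem contDiffAt_gaussMap_comp (hX : ∀ᶠ p in 𝓝 (f z), ContMDiffAt (𝓡 2) 𝓘(ℝ, L3) ∞ X p)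
    (hs : ∀ᶠ p in 𝓝 (f z), SpacelikeAt X p)
    (hf : ∀ᶠ y in 𝓝 z, ContMDiffAt 𝓘(ℝ, E) (𝓡 2) ∞ f y)
    (hinj : ∀ᶠ y in 𝓝 z, Function.Injective (mfderiv 𝓘(ℝ, E) (𝓡 2) f y))
    (he : ∀ s t : ℝ, s • e₁ + t • e₂ = 0 → s = 0 ∧ t = 0) :
    ContDiffAt ℝ ∞ (gaussMap X ∘ f) z := by
  have hfz := hf.self_of_nhds
  have hY : ContDiffAt ℝ ∞ (X ∘ f) z := (hX.self_of_nhds.comp z hfz).contDiffAt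
  have hD : ContDiffAt ℝ ∞ (fderiv ℝ (X ∘ f)) z := hY.fderiv_right (by simp)
  have hW : ContDiffAt ℝ ∞
      (fun y => wedge (fderiv ℝ (X ∘ f) y e₁) (fderiv ℝ (X ∘ f) y e₂)) z :=
    (wedgeCLM.contDiff.contDiffAt.comp z (hD.clm_apply contDiffAt_const)).clm_apply
      (hD.clm_apply contDiffAt_const)
  have hneg := gram_fderiv_pos (hX.self_of_nhds.mdifferentiableAt (by simp)) hs.self_of_nhds
    (hfz.mdifferentiableAt (by simp)) hinj.self_of_nhds he
  rw [← lorentz_wedge_self] at hneg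
  refine ((contDiffAt_downUnit (by linarith)).comp z hW).congr_of_eventuallyEq ?_
  filter_upwards [hfz.continuousAt.eventually hX, hfz.continuousAt.eventually hs, hf, hinj]
    with y h1 h2 h3 h4
  exact gaussMap_comp_eq (h1.mdifferentiableAt (by simp)) h2 (h3.mdifferentiableAt (by simp)) h4 he

end Param

end Surface

/-! ### Closed forms on the surface -/

/-- The Lorentzian metric as a continuous bilinear form. -/
def lorentzCLM : L3 →L[ℝ] L3 →L[ℝ] ℝ :=
  LinearMap.toContinuousBilinearMap <| LinearMap.mk₂ ℝ lorentz
    (fun a b c => by simp [lorentz]; ring) (fun k a b => by simp [lorentz]; ring)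
    (fun a b c => by simp [lorentz]; ring) (fun k a b => by simp [lorentz]; ring)

@[simp] theorem lorentzCLM_apply (a b : L3) : lorentzCLM a b = lorentz a b := rfl

theorem two_le_infty : (1 : ℕ∞ω) + 1 ≤ (∞ : ℕ∞ω) := by
  rw [one_add_one_eq_two]
  exact WithTop.coe_le_coe.2 (le_top : (2 : ℕ∞) ≤ ⊤)

theorem stdVec_expand (w : E2) : w = w 0 • stdVec 0 + w 1 • stdVec 1 := by
  ext i
  fin_cases i <;> simp [stdVec]

theorem stdVec_indep (s t : ℝ) (h : s • stdVec 0 + t • stdVec 1 = 0) : s = 0 ∧ t = 0 := by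
  have h0 := congrArg (fun w : E2 => w 0) h
  have h1 := congrArg (fun w : E2 => w 1) h
  simp [stdVec] at h0 h1
  exact ⟨h0, h1⟩

theorem symm_of_stdVec {F : Type*} [NormedAddCommGroup F] [NormedSpace ℝ F]
    (B : E2 →L[ℝ] E2 →L[ℝ] F) (h : B (stdVec 0) (stdVec 1) = B (stdVec 1) (stdVec 0)) (u v : E2) :
    B u v = B v u := by
  rw [stdVec_expand u, stdVec_expand v]
  simp only [map_add, map_smul, add_apply, smul_apply, h]
  module

section Surface

variable {M : Type*} [TopologicalSpace M] [ChartedSpace E2 M]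
variable {E : Type*} [NormedAddCommGroup E] [NormedSpace ℝ E]

/-- For a field `K` of endomorphisms of `𝕃³` along `M`, the pullback under `f : E → M` of the
`𝕃³`-valued one-form `K ∘ dX`. -/
def pullForm (X : M → L3) (K : M → L3 →L[ℝ] L3) (f : E → M) (z : E) : E →L[ℝ] L3 :=
  (K (f z)).comp (fderiv ℝ (X ∘ f) z)

/-- The one-form `K ∘ dX` is closed at `p`: in the chart at `p`, its derivative is symmetric. -/
def ClosedFormAt (X : M → L3) (K : M → L3 →L[ℝ] L3) (p : M) : Prop :=
  ∀ u v, fderiv ℝ (pullForm X K (extChartAt (𝓡 2) p).symm) (extChartAt (𝓡 2) p p) u v =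
    fderiv ℝ (pullForm X K (extChartAt (𝓡 2) p).symm) (extChartAt (𝓡 2) p p) v u

theorem contDiffAt_pullForm {X : M → L3} {K : M → L3 →L[ℝ] L3} {f : E → M} {z : E}
    (hX : ContMDiffAt (𝓡 2) 𝓘(ℝ, L3) ∞ X (f z))
    (hK : ContMDiffAt (𝓡 2) 𝓘(ℝ, L3 →L[ℝ] L3) ∞ K (f z))
    (hf : ContMDiffAt 𝓘(ℝ, E) (𝓡 2) ∞ f z) : ContDiffAt ℝ ∞ (pullForm X K f) z :=
  (hK.comp z hf).contDiffAt.clm_comp ((hX.comp z hf).contDiffAt.fderiv_right (by simp))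

theorem chart_eventually {p : M} {P : M → Prop} (h : ∀ᶠ p' in 𝓝 p, P p') :
    ∀ᶠ y in 𝓝 (extChartAt (𝓡 2) p p), P ((extChartAt (𝓡 2) p).symm y) := by
  have hc : ContinuousAt (extChartAt (𝓡 2) p).symm (extChartAt (𝓡 2) p p) :=
    continuousAt_extChartAt_symm p
  refine hc.eventually ?_
  rwa [extChartAt_to_inv]

theorem target_eventually (p : M) :
    ∀ᶠ y in 𝓝 (extChartAt (𝓡 2) p p), y ∈ (extChartAt (𝓡 2) p).target :=
  (isOpen_extChartAt_target p).mem_nhds (mem_extChartAt_target p)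

variable [IsManifold (𝓡 2) ∞ M]

theorem contMDiffAt_chart_symm {p : M} {y : E2} (hy : y ∈ (extChartAt (𝓡 2) p).target) :
    ContMDiffAt 𝓘(ℝ, E2) (𝓡 2) ∞ (extChartAt (𝓡 2) p).symm y :=
  (contMDiffOn_extChartAt_symm p).contMDiffAt ((isOpen_extChartAt_target p).mem_nhds hy)

theorem injective_mfderiv_chart_symm {p : M} {y : E2} (hy : y ∈ (extChartAt (𝓡 2) p).target) :
    Function.Injective (mfderiv 𝓘(ℝ, E2) (𝓡 2) (extChartAt (𝓡 2) p).symm y) := by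
  have : IsManifold (𝓡 2) 1 M := IsManifold.of_le (n := ∞) (by simp)
  have h := isInvertible_mfderivWithin_extChartAt_symm (I := 𝓡 2) hy
  rw [ModelWithCorners.Boundaryless.range_eq_univ, mfderivWithin_univ] at h
  exact h.injective

/-- Near a smooth map `f` into `M`, the pullback of a form factors through the chart. -/
theorem pullForm_eventually_eq {X : M → L3} {K : M → L3 →L[ℝ] L3} {f : E → M} {z : E}
    (hX : ∀ᶠ p in 𝓝 (f z), ContMDiffAt (𝓡 2) 𝓘(ℝ, L3) ∞ X p)
    (hf : ∀ᶠ y in 𝓝 z, ContMDiffAt 𝓘(ℝ, E) (𝓡 2) ∞ f y) :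
    pullForm X K f =ᶠ[𝓝 z] fun y =>
      (pullForm X K (extChartAt (𝓡 2) (f z)).symm (extChartAt (𝓡 2) (f z) (f y))).comp
        (fderiv ℝ (extChartAt (𝓡 2) (f z) ∘ f) y) := by
  have hc : ContinuousAt f z := hf.self_of_nhds.continuousAt
  have hsrc : ∀ᶠ y in 𝓝 z, f y ∈ (extChartAt (𝓡 2) (f z)).source :=
    hc.eventually (extChartAt_source_mem_nhds (f z))
  filter_upwards [hc.eventually hX, hf, hsrc, hsrc.eventually_nhds] with y h1 h2 h3 h4
  have e : X ∘ f =ᶠ[𝓝 y]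
      (X ∘ (extChartAt (𝓡 2) (f z)).symm) ∘ (extChartAt (𝓡 2) (f z) ∘ f) := by
    filter_upwards [h4] with w hw
    simp only [Function.comp_apply, (extChartAt (𝓡 2) (f z)).left_inv hw]
  have hφ : DifferentiableAt ℝ (extChartAt (𝓡 2) (f z) ∘ f) y := by
    have : ContMDiffAt (𝓡 2) 𝓘(ℝ, E2) ∞ (extChartAt (𝓡 2) (f z)) (f y) :=
      contMDiffAt_extChartAt' (by simpa [extChartAt_source] using h3)
    exact (this.comp y h2).contDiffAt.differentiableAt (by simp)
  have hY : DifferentiableAt ℝ (X ∘ (extChartAt (𝓡 2) (f z)).symm)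
      ((extChartAt (𝓡 2) (f z) ∘ f) y) := by
    have h5 := contMDiffAt_chart_symm ((extChartAt (𝓡 2) (f z)).map_source h3)
    have h6 : ContMDiffAt (𝓡 2) 𝓘(ℝ, L3) ∞ X
        ((extChartAt (𝓡 2) (f z)).symm (extChartAt (𝓡 2) (f z) (f y))) := by
      rwa [(extChartAt (𝓡 2) (f z)).left_inv h3]
    exact (h6.comp _ h5).contDiffAt.differentiableAt (by simp)
  rw [pullForm, pullForm, e.fderiv_eq, fderiv_comp _ hY hφ, (extChartAt (𝓡 2) (f z)).left_inv h3]
  rfl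

/-- The pullback of a closed form is closed. -/
theorem fderiv_pullForm_symm {X : M → L3} {K : M → L3 →L[ℝ] L3} {f : E → M} {z : E}
    (hX : ∀ᶠ p in 𝓝 (f z), ContMDiffAt (𝓡 2) 𝓘(ℝ, L3) ∞ X p)
    (hK : ContMDiffAt (𝓡 2) 𝓘(ℝ, L3 →L[ℝ] L3) ∞ K (f z))
    (hf : ∀ᶠ y in 𝓝 z, ContMDiffAt 𝓘(ℝ, E) (𝓡 2) ∞ f y)
    (hc : ClosedFormAt X K (f z)) (u v : E) :
    fderiv ℝ (pullForm X K f) z u v = fderiv ℝ (pullForm X K f) z v u := by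
  rw [(pullForm_eventually_eq hX hf).fderiv_eq]
  set p := f z with hp
  have hφ : ContDiffAt ℝ ∞ (extChartAt (𝓡 2) p ∘ f) z :=
    (ContMDiffAt.comp z contMDiffAt_extChartAt hf.self_of_nhds).contDiffAt
  have hA : ContDiffAt ℝ ∞ (pullForm X K (extChartAt (𝓡 2) p).symm) (extChartAt (𝓡 2) p p) := by
    refine contDiffAt_pullForm ?_ ?_ (contMDiffAt_chart_symm (mem_extChartAt_target p))
    · rw [extChartAt_to_inv]; exact hX.self_of_nhds
    · rw [extChartAt_to_inv]; exact hK
  have h1 := ((hA.differentiableAt (by simp)).hasFDerivAt).comp z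
    (hφ.differentiableAt (by simp)).hasFDerivAt
  have h2 := ((hφ.fderiv_right (m := 1) two_le_infty).differentiableAt (by simp)).hasFDerivAt
  have h3 := (h1.clm_comp h2).fderiv
  have hsymm : IsSymmSndFDerivAt ℝ (extChartAt (𝓡 2) p ∘ f) z :=
    hφ.isSymmSndFDerivAt (by simpa [one_add_one_eq_two] using two_le_infty)
  change fderiv ℝ (fun y => ((pullForm X K (extChartAt (𝓡 2) p).symm ∘
    (extChartAt (𝓡 2) p ∘ f)) y).comp (fderiv ℝ (extChartAt (𝓡 2) p ∘ f) y)) z u v =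
    fderiv ℝ (fun y => ((pullForm X K (extChartAt (𝓡 2) p).symm ∘
    (extChartAt (𝓡 2) p ∘ f)) y).comp (fderiv ℝ (extChartAt (𝓡 2) p ∘ f) y)) z v u
  rw [h3]
  simp only [add_apply, ContinuousLinearMap.comp_apply,
    ContinuousLinearMap.compL_apply, ContinuousLinearMap.flip_apply]
  rw [hsymm.eq u v]
  congr 1
  exact hc _ _

/-! ### The flux and torque forms -/

/-- The coefficient of the flux form `dX ∧ N`. -/
def fluxField (X : M → L3) (p : M) : L3 →L[ℝ] L3 := wedgeCLM.flip (gaussMap X p)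

/-- The coefficient of the torque form `X ∧ (dX ∧ N)`. -/
def torqueField (X : M → L3) (p : M) : L3 →L[ℝ] L3 := (wedgeCLM (X p)).comp (fluxField X p)

theorem contMDiffAt_gaussMap {X : M → L3} {p : M}
    (hX : ∀ᶠ p' in 𝓝 p, ContMDiffAt (𝓡 2) 𝓘(ℝ, L3) ∞ X p')
    (hs : ∀ᶠ p' in 𝓝 p, SpacelikeAt X p') : ContMDiffAt (𝓡 2) 𝓘(ℝ, L3) ∞ (gaussMap X) p := by
  have hG : ContDiffAt ℝ ∞ (gaussMap X ∘ (extChartAt (𝓡 2) p).symm) (extChartAt (𝓡 2) p p) := by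
    refine contDiffAt_gaussMap_comp ?_ ?_ ?_ ?_ stdVec_indep
    · rwa [extChartAt_to_inv]
    · rwa [extChartAt_to_inv]
    · filter_upwards [target_eventually p] with y hy using contMDiffAt_chart_symm hy
    · filter_upwards [target_eventually p] with y hy using injective_mfderiv_chart_symm hy
  have h := hG.contMDiffAt.comp p (contMDiffAt_extChartAt (I := 𝓡 2) (n := ∞) (x := p))
  refine h.congr_of_eventuallyEq ?_
  filter_upwards [extChartAt_source_mem_nhds (I := 𝓡 2) p] with y hy
  simp only [Function.comp_apply, (extChartAt (𝓡 2) p).left_inv hy]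

theorem contMDiffAt_fluxField {X : M → L3} {p : M}
    (hX : ∀ᶠ p' in 𝓝 p, ContMDiffAt (𝓡 2) 𝓘(ℝ, L3) ∞ X p')
    (hs : ∀ᶠ p' in 𝓝 p, SpacelikeAt X p') :
    ContMDiffAt (𝓡 2) 𝓘(ℝ, L3 →L[ℝ] L3) ∞ (fluxField X) p :=
  (wedgeCLM.flip.contDiff.contDiffAt.contMDiffAt).comp p (contMDiffAt_gaussMap hX hs)

theorem contMDiffAt_torqueField {X : M → L3} {p : M}
    (hX : ∀ᶠ p' in 𝓝 p, ContMDiffAt (𝓡 2) 𝓘(ℝ, L3) ∞ X p')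
    (hs : ∀ᶠ p' in 𝓝 p, SpacelikeAt X p') :
    ContMDiffAt (𝓡 2) 𝓘(ℝ, L3 →L[ℝ] L3) ∞ (torqueField X) p :=
  ((wedgeCLM.contDiff.contDiffAt.contMDiffAt).comp p hX.self_of_nhds).clm_comp
    (contMDiffAt_fluxField hX hs)

/-- On a maximal surface the flux form `dX ∧ N` is closed. -/
theorem closedFormAt_fluxField {X : M → L3} {p : M}
    (hX : ∀ᶠ p' in 𝓝 p, ContMDiffAt (𝓡 2) 𝓘(ℝ, L3) ∞ X p')
    (hs : ∀ᶠ p' in 𝓝 p, SpacelikeAt X p') (hH : meanCurvature X p = 0) :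
    ClosedFormAt X (fluxField X) p := by
  set x := extChartAt (𝓡 2) p p with hx
  set Y : E2 → L3 := X ∘ (extChartAt (𝓡 2) p).symm with hYdef
  set N : E2 → L3 := gaussMap X ∘ (extChartAt (𝓡 2) p).symm with hNdef
  have hψ := contMDiffAt_chart_symm (mem_extChartAt_target (I := 𝓡 2) p)
  have hpx : (extChartAt (𝓡 2) p).symm x = p := extChartAt_to_inv p
  have hYs : ContDiffAt ℝ ∞ Y x :=
    (ContMDiffAt.comp x (by rw [hpx]; exact hX.self_of_nhds) hψ).contDiffAt
  have hNs : ContDiffAt ℝ ∞ N x :=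
    (ContMDiffAt.comp x (by rw [hpx]; exact contMDiffAt_gaussMap hX hs) hψ).contDiffAt
  have hD : HasFDerivAt (fderiv ℝ Y) (fderiv ℝ (fderiv ℝ Y) x) x :=
    ((hYs.fderiv_right (m := 1) two_le_infty).differentiableAt (by simp)).hasFDerivAt
  have hN' : HasFDerivAt N (fderiv ℝ N x) x := (hNs.differentiableAt (by simp)).hasFDerivAt
  have hsymm : IsSymmSndFDerivAt ℝ Y x := hYs.isSymmSndFDerivAt
    (by simpa [one_add_one_eq_two] using two_le_infty)
  have hspec : ∀ᶠ y in 𝓝 x, lorentz (N y) (N y) = -1 ∧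
      ∀ v, lorentz (fderiv ℝ Y y v) (N y) = 0 := by
    filter_upwards [target_eventually p, chart_eventually hs, chart_eventually hX] with y h1 h2 h3
    obtain ⟨g1, -, g3⟩ := gaussMap_spec h2
    refine ⟨g1, fun v => ?_⟩
    rw [hYdef, fderiv_comp_eq_diffl (h3.mdifferentiableAt (by simp))
      ((contMDiffAt_chart_symm h1).mdifferentiableAt (by simp))]
    exact g3 _
  -- the derivatives of `⟨N, N⟩ = -1` and of `⟨dY v, N⟩ = 0`
  have hNN : ∀ u, lorentz (fderiv ℝ N x u) (N x) = 0 := by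
    intro u
    have h1 : HasFDerivAt (fun y => lorentzCLM (N y) (N y)) _ x :=
      (lorentzCLM.hasFDerivAt.comp x hN').clm_apply hN'
    have h2 : (fun y => lorentzCLM (N y) (N y)) =ᶠ[𝓝 x] fun _ => (-1 : ℝ) :=
      hspec.mono fun y hy => hy.1
    have h3 := congrArg (fun T => T u)
      (h1.unique ((hasFDerivAt_const (-1 : ℝ) x).congr_of_eventuallyEq h2))
    simp [lorentz] at h3
    simp only [lorentz]
    linarith
  have hYN : ∀ u v, lorentz (fderiv ℝ N x u) (fderiv ℝ Y x v) =
      -lorentz (fderiv ℝ (fderiv ℝ Y) x u v) (N x) := by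
    intro u v
    have h0 : HasFDerivAt (fun y => fderiv ℝ Y y v) _ x := hD.clm_apply (hasFDerivAt_const v x)
    have h1 : HasFDerivAt (fun y => lorentzCLM (fderiv ℝ Y y v) (N y)) _ x :=
      (lorentzCLM.hasFDerivAt.comp x h0).clm_apply hN'
    have h2 : (fun y => lorentzCLM (fderiv ℝ Y y v) (N y)) =ᶠ[𝓝 x] fun _ => (0 : ℝ) :=
      hspec.mono fun y hy => hy.2 v
    have h3 := congrArg (fun T => T u)
      (h1.unique ((hasFDerivAt_const (0 : ℝ) x).congr_of_eventuallyEq h2))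
    simp [lorentz] at h3
    simp only [lorentz]
    linarith
  have hgram : 0 < lorentz (fderiv ℝ Y x (stdVec 0)) (fderiv ℝ Y x (stdVec 0)) *
      lorentz (fderiv ℝ Y x (stdVec 1)) (fderiv ℝ Y x (stdVec 1)) -
      lorentz (fderiv ℝ Y x (stdVec 0)) (fderiv ℝ Y x (stdVec 1)) ^ 2 :=
    gram_fderiv_pos (by rw [hpx]; exact hX.self_of_nhds.mdifferentiableAt (by simp))
      (by rw [hpx]; exact hs.self_of_nhds) (hψ.mdifferentiableAt (by simp))
      (injective_mfderiv_chart_symm (mem_extChartAt_target p)) stdVec_indep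
  have hNw : N x = downUnit (wedge (fderiv ℝ Y x (stdVec 0)) (fderiv ℝ Y x (stdVec 1))) :=
    gaussMap_comp_eq (by rw [hpx]; exact hX.self_of_nhds.mdifferentiableAt (by simp))
      (by rw [hpx]; exact hs.self_of_nhds) (hψ.mdifferentiableAt (by simp))
      (injective_mfderiv_chart_symm (mem_extChartAt_target p)) stdVec_indep
  have hNx : N x = gaussMap X p := by rw [hNdef, Function.comp_apply, hpx]
  have hsecond : ∀ i j, fderiv ℝ (fun y => fderiv ℝ Y y (stdVec j)) x (stdVec i) =
      fderiv ℝ (fderiv ℝ Y) x (stdVec i) (stdVec j) := by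
    intro i j
    rw [(hD.clm_apply (hasFDerivAt_const (stdVec j) x)).fderiv]
    simp
  -- the denominator in the mean curvature is twice the Gram determinant, hence not zero
  have hkey : wedge (fderiv ℝ Y x (stdVec 0)) (fderiv ℝ N x (stdVec 1)) =
      wedge (fderiv ℝ Y x (stdVec 1)) (fderiv ℝ N x (stdVec 0)) := by
    refine wedge_shape_symm hgram hNw (hNN _) (hNN _) (hYN _ _) (hYN _ _) ?_ (hYN _ _) ?_
    · rw [hYN, hsymm.eq]
    · have h := hH
      simp only [meanCurvature] at h
      rw [← hYdef, ← hx] at h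
      simp only [hsecond, ← hNx] at h
      rcases div_eq_zero_iff.1 h with h | h
      · exact h
      · linarith
  have hA : HasFDerivAt (pullForm X (fluxField X) (extChartAt (𝓡 2) p).symm) _ x :=
    (wedgeCLM.flip.hasFDerivAt.comp x hN').clm_comp hD
  intro u v
  rw [hA.fderiv]
  refine symm_of_stdVec _ ?_ u v
  simp only [add_apply, ContinuousLinearMap.comp_apply,
    ContinuousLinearMap.compL_apply, ContinuousLinearMap.flip_apply, Function.comp_apply,
    wedgeCLM_apply]
  rw [hsymm.eq (stdVec 0) (stdVec 1), hkey]

/-- On a maximal surface the torque form `X ∧ (dX ∧ N)` is closed: its exterior derivative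
consists of the one of the flux form and of a term which, by the Jacobi identity, is the product
of the normal vector `dX(u) ∧ dX(v)` with `N`. -/
theorem closedFormAt_torqueField {X : M → L3} {p : M}
    (hX : ∀ᶠ p' in 𝓝 p, ContMDiffAt (𝓡 2) 𝓘(ℝ, L3) ∞ X p')
    (hs : ∀ᶠ p' in 𝓝 p, SpacelikeAt X p') (hH : meanCurvature X p = 0) :
    ClosedFormAt X (torqueField X) p := by
  have hflux := closedFormAt_fluxField hX hs hH
  set x := extChartAt (𝓡 2) p p with hx
  set Y : E2 → L3 := X ∘ (extChartAt (𝓡 2) p).symm with hYdef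
  have hψ := contMDiffAt_chart_symm (mem_extChartAt_target (I := 𝓡 2) p)
  have hpx : (extChartAt (𝓡 2) p).symm x = p := extChartAt_to_inv p
  have hX' : ContMDiffAt (𝓡 2) 𝓘(ℝ, L3) ∞ X ((extChartAt (𝓡 2) p).symm x) := by
    rw [hpx]; exact hX.self_of_nhds
  have hY : HasFDerivAt Y (fderiv ℝ Y x) x :=
    ((hX'.comp x hψ).contDiffAt.differentiableAt (by simp)).hasFDerivAt
  have hB : HasFDerivAt (pullForm X (fluxField X) (extChartAt (𝓡 2) p).symm)
      (fderiv ℝ (pullForm X (fluxField X) (extChartAt (𝓡 2) p).symm) x) x :=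
    ((contDiffAt_pullForm hX' (by rw [hpx]; exact contMDiffAt_fluxField hX hs)
      hψ).differentiableAt (by simp)).hasFDerivAt
  have hA : HasFDerivAt (pullForm X (torqueField X) (extChartAt (𝓡 2) p).symm) _ x :=
    (wedgeCLM.hasFDerivAt.comp x hY).clm_comp hB
  have hNw : gaussMap X p =
      downUnit (wedge (fderiv ℝ Y x (stdVec 0)) (fderiv ℝ Y x (stdVec 1))) := by
    conv_lhs => rw [← hpx]
    exact gaussMap_comp_eq (hX'.mdifferentiableAt (by simp))
      (by rw [hpx]; exact hs.self_of_nhds) (hψ.mdifferentiableAt (by simp))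
      (injective_mfderiv_chart_symm (mem_extChartAt_target p)) stdVec_indep
  intro u v
  rw [hA.fderiv]
  refine symm_of_stdVec _ ?_ u v
  simp only [add_apply, ContinuousLinearMap.comp_apply,
    ContinuousLinearMap.compL_apply, ContinuousLinearMap.flip_apply, Function.comp_apply,
    wedgeCLM_apply]
  rw [hflux (stdVec 0) (stdVec 1)]
  congr 1
  have h0 : ∀ w, pullForm X (fluxField X) (extChartAt (𝓡 2) p).symm x w =
      wedge (fderiv ℝ Y x w) (gaussMap X p) := by
    intro w
    rw [pullForm, hpx]
    rfl
  rw [h0, h0, ← sub_eq_zero, wedge_jacobi, hNw, downUnit, ← wedgeCLM_apply, map_smul,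
    wedgeCLM_apply, wedge_self, smul_zero]

end Surface

/-! ### Stokes' theorem on the unit disc -/

section Stokes

variable {F : Type*} [NormedAddCommGroup F] [NormedSpace ℝ F]

/-- The integral of a one-form over the unit circle, with the angle in `[-π, π]` as in polar
coordinates. -/
def circleInt (α : ℂ → ℂ →L[ℝ] F) : F :=
  ∫ t in (-Real.pi)..Real.pi, α (circleMap 0 1 t) (circleMap 0 1 t * Complex.I)

theorem closedBall_polar {r : ℝ} (h0 : 0 ≤ r) (h1 : r ≤ 1) (t : ℝ) :
    circleMap 0 r t ∈ Metric.closedBall (0 : ℂ) 1 := by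
  simp [abs_of_nonneg h0, h1]

theorem hasFDerivAt_circleMap (x : ℝ × ℝ) :
    HasFDerivAt (fun x : ℝ × ℝ => circleMap 0 x.1 x.2)
      ((ContinuousLinearMap.fst ℝ ℝ ℝ).smulRight (circleMap 0 1 x.2) +
        (ContinuousLinearMap.snd ℝ ℝ ℝ).smulRight (circleMap 0 x.1 x.2 * Complex.I)) x := by
  have h1 : HasFDerivAt (fun x : ℝ × ℝ => (x.1 : ℂ))
      ((ContinuousLinearMap.fst ℝ ℝ ℝ).smulRight (1 : ℂ)) x := by
    have := Complex.ofRealCLM.hasFDerivAt.comp x (ContinuousLinearMap.fst ℝ ℝ ℝ).hasFDerivAt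
    refine this.congr_fderiv ?_
    ext <;> simp
  have h2 : HasFDerivAt (fun x : ℝ × ℝ => circleMap 0 1 x.2)
      ((ContinuousLinearMap.snd ℝ ℝ ℝ).smulRight (circleMap 0 1 x.2 * Complex.I)) x := by
    have := (hasDerivAt_circleMap 0 1 x.2).hasFDerivAt.comp x
      (ContinuousLinearMap.snd ℝ ℝ ℝ).hasFDerivAt
    refine this.congr_fderiv ?_
    ext <;> simp
  have h3 := h1.mul h2
  have e : (fun x : ℝ × ℝ => circleMap 0 x.1 x.2) =
      fun x : ℝ × ℝ => (x.1 : ℂ) * circleMap 0 1 x.2 := by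
    ext x
    simp [circleMap]
  rw [e]
  refine h3.congr_fderiv ?_
  ext <;> simp [circleMap]
  ring

theorem setIntegral_ball_polar (g : ℂ → F) :
    ∫ z in Metric.ball (0 : ℂ) 1, g z =
      ∫ x in Set.Ioo (0 : ℝ) 1 ×ˢ Set.Ioo (-Real.pi) Real.pi, x.1 • g (circleMap 0 x.1 x.2) := by
  have hpol : ∀ x : ℝ × ℝ, Complex.polarCoord.symm x = circleMap 0 x.1 x.2 := by
    intro x
    rw [Complex.polarCoord_symm_apply, circleMap, Complex.exp_mul_I]
    push_cast
    ring
  have hsub : Set.Ioo (0 : ℝ) 1 ×ˢ Set.Ioo (-Real.pi) Real.pi =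
      polarCoord.target ∩ {x : ℝ × ℝ | x.1 < 1} := by
    ext x
    simp [polarCoord_target]
    tauto
  have hm : MeasurableSet {x : ℝ × ℝ | x.1 < 1} := measurableSet_lt measurable_fst measurable_const
  rw [← MeasureTheory.integral_indicator Metric.isOpen_ball.measurableSet,
    ← Complex.integral_comp_polarCoord_symm, hsub, ← MeasureTheory.setIntegral_indicator hm]
  refine MeasureTheory.setIntegral_congr_fun polarCoord.open_target.measurableSet fun x hx => ?_
  have hx0 : 0 < x.1 := by
    rw [polarCoord_target] at hx
    exact hx.1
  have hn : ‖circleMap 0 x.1 x.2‖ = x.1 := by simp [abs_of_pos hx0]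
  simp only [hpol, Set.indicator, Metric.mem_ball, dist_zero_right, hn, Set.mem_ofPred_eq]
  split_ifs <;> simp

/-- Stokes' theorem for one-forms on the closed unit disc. -/
theorem circleInt_eq_integral_ball [CompleteSpace F] {α : ℂ → ℂ →L[ℝ] F} {U : Set ℂ}
    (hU : IsOpen U) (hBU : Metric.closedBall 0 1 ⊆ U) (hα : ContDiffOn ℝ 1 α U) :
    circleInt α = ∫ z in Metric.ball (0 : ℂ) 1,
      (fderiv ℝ α z 1 Complex.I - fderiv ℝ α z Complex.I 1) := by
  rw [setIntegral_ball_polar]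
  set c : ℝ × ℝ → ℂ := fun x => circleMap 0 x.1 x.2 with hc
  set e : ℝ × ℝ → ℂ := fun x => circleMap 0 1 x.2 with he
  have hcU : ∀ x ∈ Set.Icc ((0 : ℝ), -Real.pi) (1, Real.pi), c x ∈ U := fun x hx =>
    hBU (closedBall_polar hx.1.1 hx.2.1 x.2)
  have hcd : ∀ x, HasFDerivAt c _ x := hasFDerivAt_circleMap
  have hed : ∀ x : ℝ × ℝ, HasFDerivAt e
      ((ContinuousLinearMap.snd ℝ ℝ ℝ).smulRight (e x * Complex.I)) x := by
    intro x
    refine ((hasDerivAt_circleMap 0 1 x.2).hasFDerivAt.comp x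
      (ContinuousLinearMap.snd ℝ ℝ ℝ).hasFDerivAt).congr_fderiv ?_
    ext <;> simp [he]
  have hcc : Continuous c := continuous_iff_continuousAt.2 fun x => (hcd x).continuousAt
  have hec : Continuous e := continuous_iff_continuousAt.2 fun x => (hed x).continuousAt
  have hαd : ∀ z ∈ U, HasFDerivAt α (fderiv ℝ α z) z := fun z hz =>
    ((hα.differentiableOn (by simp)).differentiableAt (hU.mem_nhds hz)).hasFDerivAt
  have hα' : ContinuousOn (fderiv ℝ α) U := hα.continuousOn_fderiv_of_isOpen hU le_rfl
  have hαc : ContinuousOn (fun x => α (c x)) (Set.Icc ((0 : ℝ), -Real.pi) (1, Real.pi)) :=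
    hα.continuousOn.comp hcc.continuousOn hcU
  have hα'c : ContinuousOn (fun x => fderiv ℝ α (c x)) (Set.Icc ((0 : ℝ), -Real.pi) (1, Real.pi)) :=
    hα'.comp hcc.continuousOn hcU
  have hce : ∀ x, c x = x.1 • e x := fun x => by simp [hc, he, circleMap]
  -- `P` and `Q` are the components of the pulled back form in polar coordinates
  have hP : ∀ x ∈ Set.Icc ((0 : ℝ), -Real.pi) (1, Real.pi),
      HasFDerivAt (fun x => α (c x) (c x * Complex.I)) _ x := fun x hx =>
    ((hαd _ (hcU x hx)).comp x (hcd x)).clm_apply ((hcd x).mul_const Complex.I)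
  have hQ : ∀ x ∈ Set.Icc ((0 : ℝ), -Real.pi) (1, Real.pi),
      HasFDerivAt (fun x => -α (c x) (e x)) _ x := fun x hx =>
    (((hαd _ (hcU x hx)).comp x (hcd x)).clm_apply (hed x)).neg
  have hcurl : ∀ (T : ℂ →L[ℝ] ℂ →L[ℝ] F) (w : ℂ),
      T w (w * Complex.I) - T (w * Complex.I) w =
        (‖w‖ ^ 2) • (T 1 Complex.I - T Complex.I 1) := by
    intro T w
    have e1 : w = w.re • (1 : ℂ) + w.im • Complex.I := by
      simp [Complex.re_add_im]
    have e2 : w * Complex.I = (-w.im) • (1 : ℂ) + w.re • Complex.I := by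
      apply Complex.ext <;> simp
    rw [e2, ← Complex.normSq_eq_norm_sq, Complex.normSq_apply]
    generalize w.re = a at *
    generalize w.im = b at *
    rw [e1]
    simp only [map_add, map_smul, add_apply, smul_apply]
    module
  -- the terms with the derivative of the tangent vectors cancel, which leaves the exterior
  -- derivative of `α` times the Jacobian `r` of polar coordinates
  have hint : ∀ x : ℝ × ℝ,
      ((α ∘ c) x ∘SL
          (Complex.I •
            ((ContinuousLinearMap.fst ℝ ℝ ℝ).smulRight (circleMap 0 1 x.2) +
              (ContinuousLinearMap.snd ℝ ℝ ℝ).smulRight (circleMap 0 x.1 x.2 * Complex.I))) +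
        (fderiv ℝ α (c x) ∘SL
              ((ContinuousLinearMap.fst ℝ ℝ ℝ).smulRight (circleMap 0 1 x.2) +
                (ContinuousLinearMap.snd ℝ ℝ ℝ).smulRight (circleMap 0 x.1 x.2 * Complex.I))).flip
          (c x * Complex.I)) (1, 0) +
      (-((α ∘ c) x ∘SL (ContinuousLinearMap.snd ℝ ℝ ℝ).smulRight (e x * Complex.I) +
          (fderiv ℝ α (c x) ∘SL
                ((ContinuousLinearMap.fst ℝ ℝ ℝ).smulRight (circleMap 0 1 x.2) +
                  (ContinuousLinearMap.snd ℝ ℝ ℝ).smulRight (circleMap 0 x.1 x.2 * Complex.I))).flip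
            (e x))) (0, 1) =
      x.1 • (fderiv ℝ α (c x) 1 Complex.I - fderiv ℝ α (c x) Complex.I 1) := by
    intro x
    have h1 : ‖e x‖ = 1 := by simp [he]
    have h2 := hcurl (fderiv ℝ α (c x)) (e x)
    rw [h1, one_pow, one_smul] at h2
    have h3 : circleMap 0 x.1 x.2 = x.1 • e x := hce x
    have h4 : circleMap 0 1 x.2 = e x := rfl
    rw [← h2, h3, h4, show c x * Complex.I = x.1 • (e x * Complex.I) by rw [hce]; simp [mul_assoc]]
    simp only [add_apply, neg_apply, ContinuousLinearMap.comp_apply, smul_apply,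
      ContinuousLinearMap.smulRight_apply, ContinuousLinearMap.coe_fst',
      ContinuousLinearMap.coe_snd', ContinuousLinearMap.flip_apply, smul_eq_mul, one_smul, zero_smul,
      add_zero, zero_add, Function.comp_apply, map_smul, smul_mul_assoc]
    rw [mul_comm Complex.I (e x)]
    module
  have hmain := MeasureTheory.integral_divergence_prod_Icc_of_hasFDerivAt_off_countable_of_le
    (fun x => α (c x) (c x * Complex.I)) (fun x => -α (c x) (e x)) _ _ ((0 : ℝ), -Real.pi)
    (1, Real.pi) ⟨zero_le_one, by simp only; linarith [Real.pi_pos]⟩ ∅ Set.countable_empty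
    (hαc.clm_apply (hcc.mul continuous_const).continuousOn) (hαc.clm_apply hec.continuousOn).neg
    (fun x hx => hP x ⟨⟨hx.1.1.1.le, hx.1.2.1.le⟩, ⟨hx.1.1.2.le, hx.1.2.2.le⟩⟩)
    (fun x hx => hQ x ⟨⟨hx.1.1.1.le, hx.1.2.1.le⟩, ⟨hx.1.1.2.le, hx.1.2.2.le⟩⟩)
  simp only [hint] at hmain
  have hcont : ContinuousOn (fun x : ℝ × ℝ => x.1 • (fderiv ℝ α (c x) 1 Complex.I -
      fderiv ℝ α (c x) Complex.I 1)) (Set.Icc ((0 : ℝ), -Real.pi) (1, Real.pi)) :=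
    continuous_fst.continuousOn.smul
      (((hα'c.clm_apply continuousOn_const).clm_apply continuousOn_const).sub
        ((hα'c.clm_apply continuousOn_const).clm_apply continuousOn_const))
  have hmain := hmain (hcont.integrableOn_compact isCompact_Icc)
  -- the sides `t = ±π` cancel by periodicity, and the side `r = 0` is mapped to a point
  have hper : ∀ r : ℝ, c (r, Real.pi) = c (r, -Real.pi) ∧ e (r, Real.pi) = e (r, -Real.pi) := by
    intro r
    have h := fun R => periodic_circleMap (0 : ℂ) R (-Real.pi)
    rw [show -Real.pi + 2 * Real.pi = Real.pi by ring] at h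
    exact ⟨h r, h 1⟩
  have hzero : ∀ t, c (0, t) = 0 := fun t => by simp [hc]
  simp only [(hper _).1, (hper _).2, sub_self, hzero, zero_mul, map_zero,
    intervalIntegral.integral_zero, sub_zero, zero_add] at hmain
  have hae : (Set.Ioo (0 : ℝ) 1 ×ˢ Set.Ioo (-Real.pi) Real.pi : Set (ℝ × ℝ))
      =ᵐ[MeasureTheory.volume] Set.Icc ((0 : ℝ), -Real.pi) (1, Real.pi) := by
    rw [← Set.Icc_prod_Icc]
    exact MeasureTheory.Measure.set_prod_ae_eq MeasureTheory.Ioo_ae_eq_Icc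
      MeasureTheory.Ioo_ae_eq_Icc
  rw [MeasureTheory.setIntegral_congr_set hae]
  exact hmain.symm

/-- The coefficient of the two-form `dρ ∧ α`. -/
def dWedge (ρ : ℂ → ℝ) (α : ℂ → ℂ →L[ℝ] F) (z : ℂ) : F :=
  fderiv ℝ ρ z 1 • α z Complex.I - fderiv ℝ ρ z Complex.I • α z 1

/-- If a closed form `α` has singularities in the disc, where the function `ρ` is locally equal to
`1`, and `ρ` vanishes on the boundary, then `(1 - ρ) α` is smooth and Stokes' theorem applies. -/
theorem circleInt_eq_neg_integral_dWedge [CompleteSpace F] {α : ℂ → ℂ →L[ℝ] F} {ρ : ℂ → ℝ}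
    {U : Set ℂ} (hU : IsOpen U) (hBU : Metric.closedBall 0 1 ⊆ U) (hρ : ContDiffOn ℝ 1 ρ U)
    (hα : ∀ z ∈ U, (ContDiffAt ℝ 1 α z ∧ ∀ u v, fderiv ℝ α z u v = fderiv ℝ α z v u) ∨
      ρ =ᶠ[𝓝 z] 1)
    (hρ0 : ∀ z, ‖z‖ = 1 → ρ z = 0) :
    circleInt α = -∫ z in Metric.ball (0 : ℂ) 1, dWedge ρ α z := by
  have hρz : ∀ z ∈ U, ContDiffAt ℝ 1 ρ z := fun z hz => hρ.contDiffAt (hU.mem_nhds hz)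
  set β : ℂ → ℂ →L[ℝ] F := fun z => (1 - ρ z) • α z with hβ
  have hβ0 : ∀ z, ρ =ᶠ[𝓝 z] 1 → β =ᶠ[𝓝 z] fun _ => 0 := by
    intro z hz
    filter_upwards [hz] with w hw
    simp [hβ, hw]
  have hβs : ContDiffOn ℝ 1 β U := by
    intro z hz
    refine ContDiffAt.contDiffWithinAt ?_
    rcases hα z hz with h | h
    · exact (contDiffAt_const.sub (hρz z hz)).smul h.1
    · exact contDiffAt_const.congr_of_eventuallyEq (hβ0 z h)
  have e1 : circleInt α = circleInt β := by
    refine intervalIntegral.integral_congr fun t _ => ?_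
    simp [hβ, hρ0 (circleMap 0 1 t) (by simp)]
  rw [e1, circleInt_eq_integral_ball hU hBU hβs, ← MeasureTheory.integral_neg]
  refine MeasureTheory.setIntegral_congr_fun Metric.isOpen_ball.measurableSet fun z hz => ?_
  have hzU : z ∈ U := hBU (Metric.ball_subset_closedBall hz)
  simp only [dWedge]
  rcases hα z hzU with h | h
  · have h1 := ((hasFDerivAt_const (1 : ℝ) z).sub
      ((hρz z hzU).differentiableAt (by simp)).hasFDerivAt).smul
      (h.1.differentiableAt (by simp)).hasFDerivAt
    have h2 : fderiv ℝ β z = _ := h1.fderiv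
    rw [h2]
    simp only [add_apply, smul_apply, ContinuousLinearMap.smulRight_apply, sub_apply, zero_apply,
      h.2 Complex.I 1]
    module
  · have h1 : fderiv ℝ ρ z = 0 := by
      rw [h.fderiv_eq]
      exact fderiv_const_apply 1
    have h2 : fderiv ℝ β z = 0 := by
      rw [(hβ0 z h).fderiv_eq]
      exact fderiv_const_apply 0
    simp [h1, h2]

theorem clm_complex_apply (T : ℂ →L[ℝ] F) (w : ℂ) : T w = w.re • T 1 + w.im • T Complex.I := by
  have e : w = w.re • (1 : ℂ) + w.im • Complex.I := by simp [Complex.re_add_im]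
  conv_lhs => rw [e]
  rw [map_add, map_smul, map_smul]

theorem det_complex (T : ℂ →L[ℝ] ℂ) :
    T.det = (T 1).re * (T Complex.I).im - (T Complex.I).re * (T 1).im := by
  rw [ContinuousLinearMap.det, ← LinearMap.det_toMatrix Complex.basisOneI, Matrix.det_fin_two]
  simp [LinearMap.toMatrix_apply]

/-- Change of variables in the integral of `dρ ∧ α`, for an injective map whose Jacobian has
sign `σ` where the integrand does not vanish for the trivial reason `dρ = 0`. -/
theorem integral_dWedge_image {α β : ℂ → ℂ →L[ℝ] F} {ρ ρ' : ℂ → ℝ} {φ : ℂ → ℂ} {s : Set ℂ} {σ : ℝ}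
    (hs : MeasurableSet s) (hφ : ∀ z ∈ s, HasFDerivAt φ (fderiv ℝ φ z) z) (hinj : Set.InjOn φ s)
    (hpull : ∀ z ∈ s, fderiv ℝ ρ' z = (fderiv ℝ ρ (φ z)).comp (fderiv ℝ φ z) ∧
      (fderiv ℝ ρ (φ z) = 0 ∨ (β z = (α (φ z)).comp (fderiv ℝ φ z) ∧
        |(fderiv ℝ φ z).det| = σ * (fderiv ℝ φ z).det))) :
    ∫ z in φ '' s, dWedge ρ α z = σ • ∫ z in s, dWedge ρ' β z := by
  rw [MeasureTheory.integral_image_eq_integral_abs_det_fderiv_smul MeasureTheory.volume hs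
    (fun z hz => (hφ z hz).hasFDerivWithinAt) hinj, ← MeasureTheory.integral_smul]
  refine MeasureTheory.setIntegral_congr_fun hs fun z hz => ?_
  obtain ⟨h1, h2⟩ := hpull z hz
  simp only [dWedge, h1]
  rcases h2 with h2 | ⟨h2, hσ⟩
  · simp [h2]
  rw [hσ, h2, det_complex, mul_smul]
  simp only [ContinuousLinearMap.comp_apply]
  generalize fderiv ℝ φ z 1 = a
  generalize fderiv ℝ φ z Complex.I = b
  generalize fderiv ℝ ρ (φ z) = R
  generalize α (φ z) = A
  rw [clm_complex_apply R a, clm_complex_apply R b, clm_complex_apply A a, clm_complex_apply A b]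
  simp only [smul_eq_mul]
  congr 1
  module

end Stokes

/-! ### Embedded discs -/

section Surface

variable {M : Type*} [TopologicalSpace M] [ChartedSpace E2 M]

namespace ClosedDisc

variable (B : ClosedDisc M)

theorem contMDiffAt_eventually {z : ℂ} (hz : z ∈ Metric.closedBall (0 : ℂ) 1) :
    ∀ᶠ w in 𝓝 z, ContMDiffAt 𝓘(ℝ, ℂ) (𝓡 2) ∞ B.toFun w := by
  obtain ⟨U, hU, hBU, h⟩ := B.smooth
  filter_upwards [hU.mem_nhds (hBU hz)] with w hw
  exact h.contMDiffAt (hU.mem_nhds hw)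

theorem contMDiffAt {z : ℂ} (hz : z ∈ Metric.closedBall (0 : ℂ) 1) :
    ContMDiffAt 𝓘(ℝ, ℂ) (𝓡 2) ∞ B.toFun z := (B.contMDiffAt_eventually hz).self_of_nhds

theorem continuousOn : ContinuousOn B.toFun (Metric.closedBall 0 1) := fun _ hz =>
  (B.contMDiffAt hz).continuousAt.continuousWithinAt

theorem isCompact_carrier : IsCompact B.carrier :=
  (isCompact_closedBall 0 1).image_of_continuousOn B.continuousOn

theorem inner_subset_carrier : B.inner ⊆ B.carrier :=
  Set.image_mono Metric.ball_subset_closedBall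

theorem bdry_subset_carrier : B.bdry ⊆ B.carrier :=
  Set.image_mono Metric.sphere_subset_closedBall

theorem disjoint_inner_bdry : Disjoint B.inner B.bdry := by
  rw [Set.disjoint_left]
  rintro _ ⟨z, hz, rfl⟩ ⟨w, hw, h⟩
  have := B.injOn (Metric.sphere_subset_closedBall hw) (Metric.ball_subset_closedBall hz) h
  subst this
  simp at hz hw
  linarith

/-- The parametrization of the disc has a continuous inverse. -/
theorem tendsto_lift [T2Space M] {T : Type*} {l : Filter T} {c : T → ℂ} {z : ℂ}
    (hz : z ∈ Metric.closedBall (0 : ℂ) 1) (hc : ∀ᶠ t in l, c t ∈ Metric.closedBall (0 : ℂ) 1)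
    (h : Filter.Tendsto (fun t => B.toFun (c t)) l (𝓝 (B.toFun z))) :
    Filter.Tendsto c l (𝓝 z) := by
  refine (isCompact_closedBall (0 : ℂ) 1).tendsto_nhds_of_unique_mapClusterPt hc ?_
  intro y hy hcl
  have h1 : MapClusterPt (B.toFun y) l (B.toFun ∘ c) :=
    hcl.continuousAt_comp (B.contMDiffAt hy).continuousAt
  have h2 : B.toFun y = B.toFun z := by
    by_contra hne
    have := h1.clusterPt
    have hd := disjoint_nhds_nhds.2 hne
    have h3 : ClusterPt (B.toFun y) (𝓝 (B.toFun z)) := this.mono h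
    exact h3.neBot.ne hd.eq_bot
  exact B.injOn hy hz h2

variable [IsManifold (𝓡 2) ∞ M]

/-- In a chart, the parametrization of the disc is a local diffeomorphism. -/
theorem exists_hasStrictFDerivAt {z : ℂ} (hz : z ∈ Metric.closedBall (0 : ℂ) 1) :
    ∃ f' : ℂ ≃L[ℝ] E2,
      HasStrictFDerivAt (extChartAt (𝓡 2) (B.toFun z) ∘ B.toFun) (f' : ℂ →L[ℝ] E2) z := by
  have : IsManifold (𝓡 2) 1 M := IsManifold.of_le (n := ∞) (by simp)
  set φ := extChartAt (𝓡 2) (B.toFun z) ∘ B.toFun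
  have hφ : ContDiffAt ℝ ∞ φ z :=
    (ContMDiffAt.comp z contMDiffAt_extChartAt (B.contMDiffAt hz)).contDiffAt
  have hinj : Function.Injective (fderiv ℝ φ z) := by
    have h := mfderiv_comp z ((contMDiffAt_extChartAt (I := 𝓡 2) (n := ∞)
      (x := B.toFun z)).mdifferentiableAt (by simp)) ((B.contMDiffAt hz).mdifferentiableAt (by simp))
    have h1 := (isInvertible_mfderiv_extChartAt (I := 𝓡 2)
      (mem_extChartAt_source (I := 𝓡 2) (B.toFun z))).injective
    have h2 : Function.Injective (mfderiv 𝓘(ℝ, ℂ) 𝓘(ℝ, E2) φ z) := by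
      rw [h]
      exact h1.comp (B.immersion z hz)
    rwa [mfderiv_eq_fderiv] at h2
  let f' : ℂ ≃ₗ[ℝ] E2 := LinearMap.linearEquivOfInjective (fderiv ℝ φ z : ℂ →ₗ[ℝ] E2) hinj
    (by simp)
  refine ⟨f'.toContinuousLinearEquiv, ?_⟩
  have h := hφ.hasStrictFDerivAt (by simp)
  have e : (f'.toContinuousLinearEquiv : ℂ →L[ℝ] E2) = fderiv ℝ φ z := by
    ext1
    rfl
  rw [e]
  exact h

theorem map_nhds {z : ℂ} (hz : z ∈ Metric.closedBall (0 : ℂ) 1) :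
    Filter.map B.toFun (𝓝 z) = 𝓝 (B.toFun z) := by
  obtain ⟨f', hf'⟩ := B.exists_hasStrictFDerivAt hz
  have h1 := hf'.map_nhds_eq_of_equiv
  have h2 : B.toFun =ᶠ[𝓝 z]
      (extChartAt (𝓡 2) (B.toFun z)).symm ∘ (extChartAt (𝓡 2) (B.toFun z) ∘ B.toFun) := by
    filter_upwards [(B.contMDiffAt hz).continuousAt.eventually
      (extChartAt_source_mem_nhds (I := 𝓡 2) (B.toFun z))] with w hw
    simp only [Function.comp_apply, (extChartAt (𝓡 2) (B.toFun z)).left_inv hw]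
  rw [Filter.map_congr h2, ← Filter.map_map, h1, Function.comp_apply]
  have h3 := map_extChartAt_symm_nhdsWithin_range (I := 𝓡 2) (B.toFun z)
  rwa [ModelWithCorners.Boundaryless.range_eq_univ, nhdsWithin_univ] at h3

theorem isOpen_inner : IsOpen B.inner := by
  rw [isOpen_iff_mem_nhds]
  rintro _ ⟨z, hz, rfl⟩
  rw [← B.map_nhds (Metric.ball_subset_closedBall hz)]
  exact Filter.image_mem_map (Metric.isOpen_ball.mem_nhds hz)

/-- A continuous lift of a smooth map to the parameter domain is smooth. -/
theorem contDiffAt_lift {E : Type*} [NormedAddCommGroup E] [NormedSpace ℝ E] {c : E → ℂ}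
    {h : E → M} {x : E}
    (hx : c x ∈ Metric.closedBall (0 : ℂ) 1) (hc : ContinuousAt c x)
    (hbc : ∀ᶠ y in 𝓝 x, B.toFun (c y) = h y) (hh : ContMDiffAt 𝓘(ℝ, E) (𝓡 2) ∞ h x) :
    ContDiffAt ℝ ∞ c x := by
  obtain ⟨f', hf'⟩ := B.exists_hasStrictFDerivAt hx
  set φ := extChartAt (𝓡 2) (B.toFun (c x)) ∘ B.toFun with hφd
  have hφ : ContDiffAt ℝ ∞ φ (c x) :=
    (ContMDiffAt.comp _ contMDiffAt_extChartAt (B.contMDiffAt hx)).contDiffAt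
  have hg := hφ.to_localInverse hf'.hasFDerivAt (by simp)
  have hleft : ∀ᶠ w in 𝓝 (c x),
      hφ.localInverse hf'.hasFDerivAt (by simp) (φ w) = w :=
    (hφ.hasStrictFDerivAt' hf'.hasFDerivAt (by simp)).eventually_left_inverse
  have hk : ContDiffAt ℝ ∞ (fun y => extChartAt (𝓡 2) (B.toFun (c x)) (h y)) x := by
    refine (ContMDiffAt.comp x ?_ hh).contDiffAt
    rw [hbc.self_of_nhds]
    exact contMDiffAt_extChartAt
  have hg' : ContDiffAt ℝ ∞ (hφ.localInverse hf'.hasFDerivAt (by simp))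
      (extChartAt (𝓡 2) (B.toFun (c x)) (h x)) := by
    rw [← hbc.self_of_nhds]
    exact hg
  refine (hg'.comp x hk).congr_of_eventuallyEq ?_
  filter_upwards [hc.eventually hleft, hbc] with y h1 h2
  rw [Function.comp_apply, ← h2]
  exact h1.symm

/-- The parametrization of the disc stays injective near the closed unit disc. -/
theorem eventually_mem_closedBall [T2Space M] {z : ℂ} (hz : z ∈ Metric.closedBall (0 : ℂ) 1) :
    ∀ᶠ w in 𝓝 z, B.toFun w ∈ B.carrier → w ∈ Metric.closedBall (0 : ℂ) 1 := by
  obtain ⟨f', hf'⟩ := B.exists_hasStrictFDerivAt hz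
  have hleft := hf'.eventually_left_inverse
  -- `c w` is the point of the closed unit disc with the same image as `w`, if there is one; it
  -- tends to `z`, where the parametrization is injective
  set l : Filter ℂ := 𝓝 z ⊓ Filter.principal {w | B.toFun w ∈ B.carrier}
  classical
  let c : ℂ → ℂ := fun w => if h : B.toFun w ∈ B.carrier then h.choose else 0
  have hc : ∀ w, B.toFun w ∈ B.carrier →
      c w ∈ Metric.closedBall (0 : ℂ) 1 ∧ B.toFun (c w) = B.toFun w := by
    intro w hw
    simp only [c, dif_pos hw]
    exact hw.choose_spec
  have hl : ∀ᶠ w in l, B.toFun w ∈ B.carrier :=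
    Filter.mem_inf_of_right (Filter.mem_principal_self _)
  have ht : Filter.Tendsto c l (𝓝 z) := by
    refine B.tendsto_lift hz (hl.mono fun w hw => (hc w hw).1) ?_
    have h1 : Filter.Tendsto B.toFun l (𝓝 (B.toFun z)) :=
      (B.contMDiffAt hz).continuousAt.mono_left inf_le_left
    exact h1.congr' (hl.mono fun w hw => (hc w hw).2.symm)
  have hfin : ∀ᶠ w in l, w ∈ Metric.closedBall (0 : ℂ) 1 := by
    filter_upwards [ht.eventually hleft, hl, hleft.filter_mono inf_le_left] with w h1 h2 h3
    rw [Function.comp_apply, (hc w h2).2] at h1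
    rw [Function.comp_apply] at h3
    rw [← h3, h1]
    exact (hc w h2).1
  exact Filter.eventually_inf_principal.1 hfin

end ClosedDisc

end Surface

/-! ### Parametrizations of the unit circle -/

section Circle

variable {c : ℝ → ℂ}

/-- The angular velocity of a curve in the unit circle. -/
def angularVelocity (c : ℝ → ℂ) (s : ℝ) : ℝ := (deriv c s * (starRingEnd ℂ) (c s)).im

theorem deriv_eq_angularVelocity (hc : Differentiable ℝ c) (h1 : ∀ s, ‖c s‖ = 1) (s : ℝ) :
    deriv c s = angularVelocity c s * Complex.I * c s := by
  have hd := (hc s).hasDerivAt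
  have hn : ∀ s, c s * (starRingEnd ℂ) (c s) = 1 := by
    intro s
    rw [Complex.mul_conj, Complex.normSq_eq_norm_sq, h1]
    norm_num
  have hre : (deriv c s * (starRingEnd ℂ) (c s)).re = 0 := by
    have h2 : HasDerivAt (fun s => c s * (starRingEnd ℂ) (c s)) _ s := hd.mul hd.star
    have h3 := h2.unique ((hasDerivAt_const s (1 : ℂ)).congr_of_eventuallyEq
      (Filter.Eventually.of_forall hn))
    have h4 := congrArg Complex.re h3
    simp at h4
    simp
    linarith
  have e : deriv c s * (starRingEnd ℂ) (c s) = angularVelocity c s * Complex.I := by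
    apply Complex.ext
    · rw [hre]; simp
    · simp [angularVelocity]
  calc deriv c s = deriv c s * (c s * (starRingEnd ℂ) (c s)) := by rw [hn, mul_one]
    _ = deriv c s * (starRingEnd ℂ) (c s) * c s := by ring
    _ = _ := by rw [e]

/-- The angle of a curve in the unit circle. -/
def angle (c : ℝ → ℂ) (s : ℝ) : ℝ :=
  Complex.arg (c 0) + ∫ t in (0 : ℝ)..s, angularVelocity c t

theorem hasDerivAt_angle (hκ : Continuous (angularVelocity c)) (s : ℝ) :
    HasDerivAt (angle c) (angularVelocity c s) s :=
  (intervalIntegral.integral_hasDerivAt_right (hκ.intervalIntegrable _ _)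
    hκ.stronglyMeasurable.stronglyMeasurableAtFilter hκ.continuousAt).const_add _

theorem circleMap_angle (hc : Differentiable ℝ c) (h1 : ∀ s, ‖c s‖ = 1)
    (hκ : Continuous (angularVelocity c)) (s : ℝ) : circleMap 0 1 (angle c s) = c s := by
  have hd : ∀ s, HasDerivAt (fun s => c s * circleMap 0 1 (-angle c s)) 0 s := by
    intro s
    have h2 := (hasDerivAt_circleMap 0 1 (-angle c s)).scomp s (hasDerivAt_angle hκ s).neg
    have h3 := (hc s).hasDerivAt.mul h2
    refine h3.congr_deriv ?_
    rw [deriv_eq_angularVelocity hc h1]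
    simp
    ring
  have h0 := is_const_of_deriv_eq_zero (fun s => (hd s).differentiableAt)
    (fun s => (hd s).deriv) s 0
  have hinv : ∀ t : ℝ, circleMap 0 1 (-t) * circleMap 0 1 t = 1 := by
    intro t
    simp [circleMap, ← Complex.exp_add]
  have hA : angle c 0 = Complex.arg (c 0) := by simp [angle]
  have harg : circleMap 0 1 (Complex.arg (c 0)) = c 0 := by
    have := Complex.norm_mul_exp_arg_mul_I (c 0)
    rw [h1] at this
    simpa [circleMap] using this
  have h4 : c 0 * circleMap 0 1 (-angle c 0) = 1 := by
    rw [hA, mul_comm]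
    nth_rewrite 2 [← harg]
    exact hinv _
  simp only [h4] at h0
  calc circleMap 0 1 (angle c s) = c s * circleMap 0 1 (-angle c s) * circleMap 0 1 (angle c s) := by
        rw [h0, one_mul]
    _ = c s := by rw [mul_assoc, hinv, mul_one]

/-- A simple closed regular curve in the unit circle runs through it exactly once, in one of the two
directions. -/
theorem integral_simple_loop {F : Type*} [NormedAddCommGroup F] [NormedSpace ℝ F] {L : ℝ}
    (hL : 0 < L) (hc : ContDiff ℝ ∞ c) (h1 : ∀ s, ‖c s‖ = 1) (hper : c L = c 0)
    (hinj : Set.InjOn c (Set.Ico 0 L)) (hreg : ∀ s, deriv c s ≠ 0) :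
    ∃ σ : ℝ, (σ = 1 ∨ σ = -1) ∧ (∀ s, 0 < σ * angularVelocity c s) ∧
      ∀ α : ℂ → ℂ →L[ℝ] F, ContinuousOn α (Metric.sphere 0 1) →
        ∫ s in (0 : ℝ)..L, α (c s) (deriv c s) = σ • circleInt α := by
  have hcd : Differentiable ℝ c := hc.differentiable (by simp)
  have hκ : Continuous (angularVelocity c) :=
    Complex.continuous_im.comp ((hc.continuous_deriv (by simp)).mul
      (Complex.continuous_conj.comp hc.continuous))
  have hκ0 : ∀ s, angularVelocity c s ≠ 0 := by
    intro s h
    apply hreg s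
    rw [deriv_eq_angularVelocity hcd h1, h]
    simp
  obtain ⟨σ, hσ, hσκ⟩ : ∃ σ : ℝ, (σ = 1 ∨ σ = -1) ∧ ∀ s, 0 < σ * angularVelocity c s := by
    have hiv := fun a b => mem_range_of_exists_le_of_exists_ge hκ (c := 0) a b
    by_cases h : ∃ s, 0 < angularVelocity c s
    · refine ⟨1, Or.inl rfl, fun s => ?_⟩
      rw [one_mul]
      by_contra hs
      obtain ⟨t, ht⟩ := hiv ⟨s, not_lt.1 hs⟩ (h.imp fun _ => le_of_lt)
      exact hκ0 t ht
    · refine ⟨-1, Or.inr rfl, fun s => ?_⟩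
      have := lt_of_le_of_ne (not_lt.1 (not_exists.1 h s)) (hκ0 s)
      linarith
  refine ⟨σ, hσ, hσκ, fun α hα => ?_⟩
  have hσ2 : σ * σ = 1 := by rcases hσ with h | h <;> rw [h] <;> norm_num
  have hθ := fun s => hasDerivAt_angle hκ s
  have hθc := circleMap_angle hcd h1 hκ
  set η : ℝ → ℝ := fun s => σ * (angle c s - angle c 0) with hη
  have hηd : ∀ s, HasDerivAt η (σ * angularVelocity c s) s := fun s =>
    ((hθ s).sub_const _).const_mul σ
  have hηm : StrictMono η := strictMono_of_hasDerivAt_pos hηd hσκ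
  have hη0 : η 0 = 0 := by simp [hη]
  have hηc : ∀ s, c s = circleMap 0 1 (angle c 0 + σ * η s) := by
    intro s
    rw [← hθc s, hη]
    congr 1
    linear_combination -(angle c s - angle c 0) * hσ2
  -- the total angle is a positive multiple of `2π`, and after `2π` the curve closes up
  have hηL : η L = 2 * Real.pi := by
    have hpos : 0 < η L := hη0 ▸ hηm hL
    have hk : ∃ k : ℤ, η L = k * (2 * Real.pi) := by
      have h2 : circleMap 0 1 (angle c L) = circleMap 0 1 (angle c 0) := by
        rw [hθc, hθc, hper]
      simp only [circleMap, zero_add, Complex.ofReal_one, one_mul] at h2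
      obtain ⟨k, hk⟩ := Complex.exp_eq_exp_iff_exists_int.1 h2
      have h3 : angle c L = angle c 0 + k * (2 * Real.pi) := by
        have := congrArg Complex.im hk
        simpa using this
      rcases hσ with h | h
      · exact ⟨k, by simp only [hη, h3, h]; ring⟩
      · exact ⟨-k, by simp only [hη, h3, h]; push_cast; ring⟩
    obtain ⟨k, hk⟩ := hk
    have hk1 : 1 ≤ k := by
      have : (0 : ℝ) < k := by
        by_contra hneg
        have := mul_nonpos_of_nonpos_of_nonneg (not_lt.1 hneg) Real.two_pi_pos.le
        linarith
      exact_mod_cast this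
    have hge : 2 * Real.pi ≤ η L := by
      rw [hk]
      have : (1 : ℝ) ≤ k := by exact_mod_cast hk1
      nlinarith [Real.pi_pos]
    refine le_antisymm (not_lt.1 fun hlt => ?_) hge
    have hηcont : Continuous η := continuous_iff_continuousAt.2 fun s => (hηd s).continuousAt
    obtain ⟨s, hs, hs2⟩ := intermediate_value_Icc hL.le hηcont.continuousOn
      (show 2 * Real.pi ∈ Set.Icc (η 0) (η L) from
        ⟨by rw [hη0]; exact Real.two_pi_pos.le, hge⟩)
    have hsL : s < L := lt_of_le_of_ne hs.2 fun h => by rw [h] at hs2; linarith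
    have hs0 : s ≠ 0 := fun h => by
      rw [h, hη0] at hs2
      linarith [Real.two_pi_pos]
    apply hs0
    refine hinj ⟨hs.1, hsL⟩ ⟨le_rfl, hL⟩ ?_
    rw [hηc s, hηc 0, hη0, hs2, mul_zero, add_zero]
    have hp := periodic_circleMap (0 : ℂ) 1
    rcases hσ with h | h
    · rw [h, one_mul, hp]
    · rw [h, neg_one_mul, ← sub_eq_add_neg, hp.sub_eq]
  set H : ℝ → F := fun t => α (circleMap 0 1 t) (circleMap 0 1 t * Complex.I) with hH
  have hHc : Continuous H :=
    (hα.comp_continuous (continuous_circleMap 0 1) fun t => by simp).clm_apply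
      ((continuous_circleMap 0 1).mul continuous_const)
  have hHp : Function.Periodic H (2 * Real.pi) := by
    intro t
    simp only [hH, periodic_circleMap (0 : ℂ) 1 t]
  have e1 : ∫ s in (0 : ℝ)..L, α (c s) (deriv c s) = ∫ t in angle c 0..angle c L, H t := by
    rw [← intervalIntegral.integral_deriv_smul_comp (fun s _ => hθ s) hκ.continuousOn hHc]
    refine intervalIntegral.integral_congr fun s _ => ?_
    simp only [Function.comp_apply, hH, hθc]
    rw [deriv_eq_angularVelocity hcd h1, ← map_smul]
    congr 1
    rw [Complex.real_smul]
    ring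
  have e2 : circleInt α = ∫ t in (-Real.pi)..(-Real.pi + 2 * Real.pi), H t := by
    rw [circleInt]
    congr 1
    ring
  have hL' : angle c L = angle c 0 + σ * (2 * Real.pi) := by
    rw [← hηL, hη]
    linear_combination -(angle c L - angle c 0) * hσ2
  rw [e1, e2, hL']
  rcases hσ with h | h
  · rw [h, one_mul, one_smul, hHp.intervalIntegral_add_eq _ (-Real.pi)]
  · rw [h, intervalIntegral.integral_symm, neg_one_smul,
      ← hHp.intervalIntegral_add_eq (angle c 0 + -1 * (2 * Real.pi)) (-Real.pi)]
    congr 2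
    ring

end Circle

/-! ### Orientations of discs and of their boundaries -/

section Surface

variable {M : Type*} [TopologicalSpace M] [ChartedSpace E2 M]

/-- The signed area density, for the orientation given by the Gauss map, of a parametrization `f`
of the surface. -/
def signedJacobian (X : M → L3) (f : ℂ → M) (z : ℂ) : ℝ :=
  lorentz (wedge (fderiv ℝ (X ∘ f) z 1) (fderiv ℝ (X ∘ f) z Complex.I)) (gaussMap X (f z))

theorem wedge_clm (T : ℂ →L[ℝ] L3) (u v : ℂ) :
    wedge (T u) (T v) = (u.re * v.im - u.im * v.re) • wedge (T 1) (T Complex.I) := by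
  rw [clm_complex_apply T u, clm_complex_apply T v, wedge_add_smul]

theorem lorentz_smul_left (k : ℝ) (a b : L3) : lorentz (k • a) b = k * lorentz a b := by
  simp only [lorentz, Pi.smul_apply, smul_eq_mul]
  ring

theorem signedJacobian_comp {X : M → L3} {f g : ℂ → M} {φ : ℂ → ℂ} {z : ℂ}
    (hg : g =ᶠ[𝓝 z] f ∘ φ) (hφ : DifferentiableAt ℝ φ z)
    (hf : DifferentiableAt ℝ (X ∘ f) (φ z)) :
    signedJacobian X g z = (fderiv ℝ φ z).det * signedJacobian X f (φ z) := by
  have e : X ∘ g =ᶠ[𝓝 z] (X ∘ f) ∘ φ := hg.fun_comp X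
  have h : fderiv ℝ (X ∘ g) z = (fderiv ℝ (X ∘ f) (φ z)).comp (fderiv ℝ φ z) := by
    rw [e.fderiv_eq, fderiv_comp _ hf hφ]
  rw [signedJacobian, h, hg.self_of_nhds]
  simp only [ContinuousLinearMap.comp_apply]
  rw [wedge_clm, lorentz_smul_left, det_complex, signedJacobian]
  simp only [Function.comp_apply]
  ring

theorem one_I_indep (s t : ℝ) (h : s • (1 : ℂ) + t • Complex.I = 0) : s = 0 ∧ t = 0 := by
  have h0 := congrArg Complex.re h
  have h1 := congrArg Complex.im h
  simp at h0 h1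
  exact ⟨h0, h1⟩

theorem signedJacobian_ne_zero {X : M → L3} {f : ℂ → M} {z : ℂ}
    (hX : MDifferentiableAt (𝓡 2) 𝓘(ℝ, L3) X (f z))
    (hs : SpacelikeAt X (f z)) (hf : MDifferentiableAt 𝓘(ℝ, ℂ) (𝓡 2) f z)
    (hinj : Function.Injective (mfderiv 𝓘(ℝ, ℂ) (𝓡 2) f z)) : signedJacobian X f z ≠ 0 := by
  have hN := gaussMap_comp_eq hX hs hf hinj one_I_indep
  have h1 := (gaussMap_spec hs).1
  rw [signedJacobian]
  rw [hN, downUnit] at h1 ⊢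
  rw [lorentz_smul_smul] at h1
  set k := -(SignType.sign (wedge (fderiv ℝ (X ∘ f) z 1) (fderiv ℝ (X ∘ f) z Complex.I) 2) : ℝ) /
    √(-lorentz (wedge (fderiv ℝ (X ∘ f) z 1) (fderiv ℝ (X ∘ f) z Complex.I))
      (wedge (fderiv ℝ (X ∘ f) z 1) (fderiv ℝ (X ∘ f) z Complex.I)))
  set m := wedge (fderiv ℝ (X ∘ f) z 1) (fderiv ℝ (X ∘ f) z Complex.I)
  have e : lorentz m (k • m) = k * lorentz m m := by
    simp only [lorentz, Pi.smul_apply, smul_eq_mul]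
    ring
  rw [e]
  intro h0
  have : k ^ 2 * lorentz m m = k * (k * lorentz m m) := by ring
  rw [this, h0] at h1
  norm_num at h1

theorem isPreconnected_closedBall_diff {T : Set ℂ} (hT : T.Finite) :
    IsPreconnected (Metric.closedBall (0 : ℂ) 1 \ T) := by
  have h1 : IsPreconnected (Metric.ball (0 : ℂ) 1 \ T) := by
    let e := OpenPartialHomeomorph.univUnitBall (E := ℂ)
    have hsrc : e.source = Set.univ := rfl
    have htgt : e.target = Metric.ball 0 1 := rfl
    have hinj : Function.Injective e := fun x y h =>
      e.injOn (hsrc ▸ Set.mem_univ x) (hsrc ▸ Set.mem_univ y) h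
    have hc : (e ⁻¹' T)ᶜ.Nonempty ∧ IsPreconnected (e ⁻¹' T)ᶜ :=
      (Set.Countable.isConnected_compl_of_one_lt_rank (by simp)
        ((hT.preimage hinj.injOn).countable))
    have himg : e '' (e ⁻¹' T)ᶜ = Metric.ball (0 : ℂ) 1 \ T := by
      ext y
      constructor
      · rintro ⟨x, hx, rfl⟩
        exact ⟨htgt ▸ e.map_source (hsrc ▸ Set.mem_univ x), hx⟩
      · rintro ⟨hy, hyT⟩
        have hy' : y ∈ e.target := htgt ▸ hy
        exact ⟨e.symm y, by rwa [Set.mem_compl_iff, Set.mem_preimage, e.right_inv hy'],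
          e.right_inv hy'⟩
    rw [← himg]
    refine hc.2.image _ ?_
    have : ContinuousOn e e.source := e.continuousOn
    exact this.mono (hsrc ▸ Set.subset_univ _)
  refine h1.subset_closure (Set.sdiff_subset_sdiff_left Metric.ball_subset_closedBall) ?_
  rw [← closure_ball (0 : ℂ) one_ne_zero]
  have hTo : IsOpen Tᶜ := hT.isClosed.isOpen_compl
  exact hTo.closure_inter

/-- `X` is a smooth spacelike immersion off the finite set `S`. -/
structure IsSpacelikeOff (X : M → L3) (S : Set M) : Prop where
  finite : S.Finite
  smooth : ∀ p ∉ S, ContMDiffAt (𝓡 2) 𝓘(ℝ, L3) ∞ X p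
  spacelike : ∀ p ∉ S, SpacelikeAt X p

section

variable [T2Space M] {X : M → L3} {S : Set M} (hX : IsSpacelikeOff X S)
include hX

theorem IsSpacelikeOff.eventually {p : M} (hp : p ∉ S) {P : M → Prop} (h : ∀ p ∉ S, P p) :
    ∀ᶠ p' in 𝓝 p, P p' :=
  Filter.mem_of_superset (hX.finite.isClosed.isOpen_compl.mem_nhds hp) h

variable [IsManifold (𝓡 2) ∞ M]

theorem IsSpacelikeOff.contMDiffAt_gaussMap {p : M} (hp : p ∉ S) :
    ContMDiffAt (𝓡 2) 𝓘(ℝ, L3) ∞ (gaussMap X) p :=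
  MaximalSurface.contMDiffAt_gaussMap (hX.eventually hp hX.smooth) (hX.eventually hp hX.spacelike)

/-- The signed area density of a disc has constant sign, since the complement of finitely many
points in the disc is connected. -/
theorem ClosedDisc.exists_sign_signedJacobian (B : ClosedDisc M) :
    ∃ τ : ℝ, (τ = 1 ∨ τ = -1) ∧ ∀ z ∈ Metric.closedBall (0 : ℂ) 1, B.toFun z ∉ S →
      0 < τ * signedJacobian X B.toFun z := by
  set A : Set ℂ := {z ∈ Metric.closedBall (0 : ℂ) 1 | B.toFun z ∉ S} with hA
  have hAc : IsPreconnected A := by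
    have hT : {z ∈ Metric.closedBall (0 : ℂ) 1 | B.toFun z ∈ S}.Finite := by
      refine Set.Finite.of_finite_image (f := B.toFun) (hX.finite.subset ?_)
        (B.injOn.mono fun z hz => hz.1)
      rintro _ ⟨z, hz, rfl⟩
      exact hz.2
    have e : A = Metric.closedBall (0 : ℂ) 1 \
        {z ∈ Metric.closedBall (0 : ℂ) 1 | B.toFun z ∈ S} := by
      ext z
      simp [hA]
      tauto
    rw [e]
    exact isPreconnected_closedBall_diff hT
  have hcont : ContinuousOn (signedJacobian X B.toFun) A := by
    intro z hz
    refine ContinuousAt.continuousWithinAt ?_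
    have hY : ContDiffAt ℝ ∞ (X ∘ B.toFun) z :=
      ((hX.smooth _ hz.2).comp z (B.contMDiffAt hz.1)).contDiffAt
    have hD : ContinuousAt (fderiv ℝ (X ∘ B.toFun)) z :=
      (hY.fderiv_right (m := 0) (by simp)).continuousAt
    have hG : ContinuousAt (fun z => gaussMap X (B.toFun z)) z :=
      ((hX.contMDiffAt_gaussMap hz.2).comp z (B.contMDiffAt hz.1)).continuousAt
    have hW : ContinuousAt (fun z => wedgeCLM (fderiv ℝ (X ∘ B.toFun) z 1)
        (fderiv ℝ (X ∘ B.toFun) z Complex.I)) z :=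
      ((wedgeCLM.continuous.continuousAt).comp (hD.clm_apply continuousAt_const)).clm_apply
        (hD.clm_apply continuousAt_const)
    exact ((lorentzCLM.continuous.continuousAt).comp hW).clm_apply hG
  have hne : ∀ z ∈ A, signedJacobian X B.toFun z ≠ 0 := fun z hz =>
    signedJacobian_ne_zero ((hX.smooth _ hz.2).mdifferentiableAt (by simp)) (hX.spacelike _ hz.2)
      ((B.contMDiffAt hz.1).mdifferentiableAt (by simp)) (B.immersion z hz.1)
  by_cases h : ∃ z ∈ A, 0 < signedJacobian X B.toFun z
  · obtain ⟨w, hw, hw0⟩ := h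
    refine ⟨1, Or.inl rfl, fun z hz hzS => ?_⟩
    rw [one_mul]
    by_contra hneg
    obtain ⟨y, hy, hy0⟩ := hAc.intermediate_value ⟨hz, hzS⟩ hw hcont ⟨not_lt.1 hneg, hw0.le⟩
    exact hne y hy hy0
  · refine ⟨-1, Or.inr rfl, fun z hz hzS => ?_⟩
    have h1 : signedJacobian X B.toFun z ≤ 0 := not_lt.1 fun h' => h ⟨z, ⟨hz, hzS⟩, h'⟩
    have h2 := lt_of_le_of_ne h1 (hne z ⟨hz, hzS⟩)
    linarith

end

section Outward

variable [IsManifold (𝓡 2) ∞ M] (B : ClosedDisc M)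

/-- Every tangent vector at a point of the disc is the image of some `w : ℂ`, and the straight
segment in its direction in the chart lifts to a curve with velocity `w`. The segment is the one in
terms of which `PointsOutOf` is defined. -/
theorem ClosedDisc.exists_tangent_lift {z : ℂ} (hz : z ∈ Metric.closedBall (0 : ℂ) 1)
    (v : E2) : ∃ (w : ℂ) (k : ℝ → ℂ), k 0 = z ∧ HasDerivAt k w 0 ∧
      (∀ᶠ t in 𝓝 (0 : ℝ), B.toFun (k t) = (extChartAt (𝓡 2) (B.toFun z)).symm
        (extChartAt (𝓡 2) (B.toFun z) (B.toFun z) + t • v)) ∧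
      ∀ X : M → L3, ContMDiffAt (𝓡 2) 𝓘(ℝ, L3) ∞ X (B.toFun z) →
        diffl X (B.toFun z) v = fderiv ℝ (X ∘ B.toFun) z w := by
  obtain ⟨f', hf'⟩ := B.exists_hasStrictFDerivAt hz
  set p := B.toFun z with hp
  set φ := extChartAt (𝓡 2) p ∘ B.toFun with hφ
  set x := extChartAt (𝓡 2) p p with hx
  have hline : HasDerivAt (fun t : ℝ => x + t • v) v 0 := by
    simpa using ((hasDerivAt_id (0 : ℝ)).smul_const v).const_add x
  have hg := hf'.to_localInverse
  have hk0 : hf'.localInverse φ f' z (x + (0 : ℝ) • v) = z := by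
    rw [zero_smul, add_zero]
    exact hf'.localInverse_apply_image
  have hkd : HasDerivAt (fun t : ℝ => hf'.localInverse φ f' z (x + t • v)) (f'.symm v) 0 := by
    have h1 : HasFDerivAt (hf'.localInverse φ f' z) (f'.symm : E2 →L[ℝ] ℂ) (x + (0 : ℝ) • v) := by
      rw [zero_smul, add_zero]
      exact hg.hasFDerivAt
    exact h1.comp_hasDerivAt 0 hline
  refine ⟨f'.symm v, fun t => hf'.localInverse φ f' z (x + t • v), hk0, hkd, ?_, ?_⟩
  · have h1 : Filter.Tendsto (fun t : ℝ => x + t • v) (𝓝 0) (𝓝 (φ z)) := by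
      have := hline.continuousAt.tendsto
      rwa [zero_smul, add_zero] at this
    have h2 : Filter.Tendsto (fun t : ℝ => hf'.localInverse φ f' z (x + t • v)) (𝓝 0) (𝓝 z) := by
      have := hkd.continuousAt.tendsto
      rwa [hk0] at this
    filter_upwards [h1.eventually hf'.eventually_right_inverse,
      h2.eventually ((B.contMDiffAt hz).continuousAt.eventually
        (extChartAt_source_mem_nhds (I := 𝓡 2) (B.toFun z)))] with t ht1 ht2
    have h3 := (extChartAt (𝓡 2) p).left_inv ht2
    exact h3.symm.trans (congrArg (extChartAt (𝓡 2) p).symm ht1)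
  · intro X hXp
    have hXm := hXp.mdifferentiableAt (by simp : (∞ : ℕ∞ω) ≠ 0)
    have hbm := (B.contMDiffAt hz).mdifferentiableAt (by simp : (∞ : ℕ∞ω) ≠ 0)
    rw [fderiv_comp_eq_diffl hXm hbm]
    congr 1
    -- in the chart at `p`, the differential of the parametrization is `f'`
    have h1 : (mfderiv 𝓘(ℝ, ℂ) (𝓡 2) B.toFun z : ℂ →L[ℝ] E2) = (f' : ℂ →L[ℝ] E2) := by
      refine hbm.mfderiv.trans ?_
      have e : writtenInExtChartAt 𝓘(ℝ, ℂ) (𝓡 2) z B.toFun = φ := rfl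
      rw [e, ModelWithCorners.Boundaryless.range_eq_univ, fderivWithin_univ]
      exact hf'.hasFDerivAt.fderiv
    exact (f'.apply_symm_apply v).symm.trans
      (congrArg (fun T : ℂ →L[ℝ] E2 => T (f'.symm v)) h1).symm

theorem hasDerivAt_normSq {k : ℝ → ℂ} {w : ℂ} (hk : HasDerivAt k w 0) :
    HasDerivAt (fun t => ‖k t‖ ^ 2) (2 * (w * (starRingEnd ℂ) (k 0)).re) 0 := by
  have := hk.norm_sq
  refine this.congr_deriv ?_
  rw [Complex.inner]

theorem eventually_lt_of_hasDerivAt_neg {f : ℝ → ℝ} {f' : ℝ} (h : HasDerivAt f f' 0)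
    (hf' : f' < 0) : ∀ᶠ t in 𝓝[>] (0 : ℝ), f t < f 0 := by
  have h1 := (hasDerivAt_iff_tendsto_slope.1 h).eventually_lt_const hf'
  have h2 : 𝓝[>] (0 : ℝ) ≤ 𝓝[≠] 0 := nhdsWithin_mono _ fun t ht => ne_of_gt ht
  filter_upwards [h1.filter_mono h2, self_mem_nhdsWithin] with t ht ht0
  rw [slope_def_field, sub_zero, div_lt_iff₀ ht0, zero_mul] at ht
  linarith

end Outward

end Surface

/-! ### Integration along oriented boundary curves -/

section Surface

variable {M : Type*} [TopologicalSpace M] [ChartedSpace E2 M]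
  {X : M → L3} {S : Set M} {Ω : Set M} {B : ClosedDisc M} {γ : ℝ → M} {L : ℝ}

/-- The velocity of a curve on the surface, in terms of its lift to the parameter domain. -/
theorem diffl_velocity_eq (hX : IsSpacelikeOff X S) {c : ℝ → ℂ} (hc : ContDiff ℝ ∞ c)
    (h1 : ∀ s, ‖c s‖ = 1) (hbc : ∀ s, B.toFun (c s) = γ s)
    (hγs : ContMDiff 𝓘(ℝ, ℝ) (𝓡 2) ∞ γ) (hS : Disjoint B.bdry S) (s : ℝ) :
    diffl X (γ s) (velocity γ s) = fderiv ℝ (X ∘ B.toFun) (c s) (deriv c s) := by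
  have hmem : c s ∈ Metric.closedBall (0 : ℂ) 1 := by simp [h1 s]
  have hsS : B.toFun (c s) ∉ S :=
    Set.disjoint_left.1 hS ⟨c s, by simp [h1 s], rfl⟩
  have hXs := hX.smooth _ hsS
  have e : X ∘ γ = (X ∘ B.toFun) ∘ c := by
    ext1 s
    simp [hbc]
  have h2 := fderiv_comp_eq_diffl (X := X) (f := γ) (z := s)
    ((hbc s ▸ hXs).mdifferentiableAt (by simp)) ((hγs s).mdifferentiableAt (by simp)) (1 : ℝ)
  rw [velocity, ← h2, e,
    fderiv_comp s ((hXs.comp _ (B.contMDiffAt hmem)).contDiffAt.differentiableAt (by simp))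
      (hc.differentiable (by simp) s)]
  rfl

/-- The integral of a form over an oriented boundary curve is, up to sign, its integral over the
parameter circle. The sign `σ` is the one of the angular velocity of the curve. -/
theorem IsOrientedBoundaryCurve.integral_eq (hX : IsSpacelikeOff X S)
    (hγ : IsOrientedBoundaryCurve X Ω B γ L) {c : ℝ → ℂ} (hc : ContDiff ℝ ∞ c)
    (h1 : ∀ s, ‖c s‖ = 1) (hbc : ∀ s, B.toFun (c s) = γ s) (hS : Disjoint B.bdry S) :
    ∃ σ : ℝ, (σ = 1 ∨ σ = -1) ∧ (∀ s, 0 < σ * angularVelocity c s) ∧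
      ∀ K : M → L3 →L[ℝ] L3, (∀ p ∉ S, ContMDiffAt (𝓡 2) 𝓘(ℝ, L3 →L[ℝ] L3) ∞ K p) →
        ∫ s in (0 : ℝ)..L, K (γ s) (diffl X (γ s) (velocity γ s)) =
          σ • circleInt (pullForm X K B.toFun) := by
  have hvel := diffl_velocity_eq hX hc h1 hbc hγ.isArclengthLoop.smooth hS
  have hmem : ∀ s, c s ∈ Metric.closedBall (0 : ℂ) 1 := fun s => by simp [h1 s]
  have hreg : ∀ s, deriv c s ≠ 0 := by
    intro s h
    have h2 := hγ.isArclengthLoop.arclength s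
    rw [hvel, h, map_zero] at h2
    simp [lorentz] at h2
  have hper : c L = c 0 := by
    refine B.injOn (hmem L) (hmem 0) ?_
    rw [hbc, hbc]
    simpa using hγ.isArclengthLoop.periodic 0
  have hinj : Set.InjOn c (Set.Ico 0 L) := fun s hs t ht h =>
    hγ.simple hs ht (by rw [← hbc, ← hbc, h])
  obtain ⟨σ, hσ, hσκ, hint⟩ := integral_simple_loop (F := L3) hγ.isArclengthLoop.pos hc h1 hper
    hinj hreg
  refine ⟨σ, hσ, hσκ, fun K hK => ?_⟩
  rw [← hint (pullForm X K B.toFun)]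
  · refine intervalIntegral.integral_congr fun s _ => ?_
    simp only [pullForm, ContinuousLinearMap.comp_apply]
    rw [hvel, hbc]
  · intro z hz
    have hzS : B.toFun z ∉ S := Set.disjoint_left.1 hS ⟨z, hz, rfl⟩
    exact (contDiffAt_pullForm (hX.smooth _ hzS) (hK _ hzS)
      (B.contMDiffAt (Metric.sphere_subset_closedBall hz))).continuousAt.continuousWithinAt

variable [IsManifold (𝓡 2) ∞ M]

/-- At a point of the boundary, the exterior conormal is the image of a vector `w` of the parameter
domain. The last equation expresses that the conormal and the velocity form an orthonormal positive
basis, so the sign of the radial component of `w` determines the direction of the curve. -/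
theorem IsOrientedBoundaryCurve.exists_outward (hX : IsSpacelikeOff X S)
    (hγ : IsOrientedBoundaryCurve X Ω B γ L) {c : ℝ → ℂ} (hc : ContDiff ℝ ∞ c)
    (h1 : ∀ s, ‖c s‖ = 1) (hbc : ∀ s, B.toFun (c s) = γ s) (hS : Disjoint B.bdry S) (s : ℝ) :
    ∃ (w : ℂ) (k : ℝ → ℂ), k 0 = c s ∧ HasDerivAt k w 0 ∧
      (∀ᶠ t in 𝓝[>] (0 : ℝ), B.toFun (k t) ∉ Ω) ∧
      signedJacobian X B.toFun (c s) * angularVelocity c s *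
        (w * (starRingEnd ℂ) (c s)).re = 1 := by
  have hmem : c s ∈ Metric.closedBall (0 : ℂ) 1 := by simp [h1 s]
  have hsS : B.toFun (c s) ∉ S := Set.disjoint_left.1 hS ⟨c s, by simp [h1 s], rfl⟩
  obtain ⟨v, hv, hout⟩ := hγ.exterior s
  have hvel := diffl_velocity_eq hX hc h1 hbc hγ.isArclengthLoop.smooth hS s
  have hν := (conormal_spec (X := X) (p := γ s) (hbc s ▸ hX.spacelike _ hsS) (velocity γ s)
    (hγ.isArclengthLoop.arclength s)).2.1
  have hdet : lorentz (wedge (conormal X (γ s) (velocity γ s)) (diffl X (γ s) (velocity γ s)))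
      (gaussMap X (γ s)) = 1 := by
    rw [← hν]
    simp [conormal, lorentz, wedge]
    ring
  generalize hN : conormal X (γ s) (velocity γ s) = ν at *
  rw [hvel] at hdet
  clear hvel
  obtain ⟨w, k, hk0, hkd, hkb, hw⟩ := B.exists_tangent_lift hmem v
  rw [hbc s] at hkb hw
  refine ⟨w, k, hk0, hkd, ?_, ?_⟩
  · filter_upwards [hout, hkb.filter_mono nhdsWithin_le_nhds] with t h2 h3
    rw [h3]
    exact h2
  · have hw' := hw X (hbc s ▸ hX.smooth _ hsS)
    have hνw : ν = fderiv ℝ (X ∘ B.toFun) (c s) w := hv.symm.trans hw'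
    rw [hνw, wedge_clm, lorentz_smul_left] at hdet
    rw [← hdet, signedJacobian, hbc s,
      deriv_eq_angularVelocity (hc.differentiable (by simp)) h1]
    simp
    ring

variable [T2Space M]

theorem IsOrientedBoundaryCurve.exists_lift (hγ : IsOrientedBoundaryCurve X Ω B γ L) :
    ∃ c : ℝ → ℂ, ContDiff ℝ ∞ c ∧ (∀ s, ‖c s‖ = 1) ∧ ∀ s, B.toFun (c s) = γ s := by
  have h : ∀ s, ∃ z : ℂ, ‖z‖ = 1 ∧ B.toFun z = γ s := by
    intro s
    have : γ s ∈ B.bdry := hγ.range_eq ▸ Set.mem_range_self s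
    obtain ⟨z, hz, h⟩ := this
    exact ⟨z, by simpa using hz, h⟩
  choose c hc1 hc2 using h
  have hmem : ∀ s, c s ∈ Metric.closedBall (0 : ℂ) 1 := fun s => by simp [hc1 s]
  have hcont : ∀ s, ContinuousAt c s := fun s => by
    refine B.tendsto_lift (hmem s) (Filter.Eventually.of_forall hmem) ?_
    simp only [hc2]
    exact (hγ.isArclengthLoop.smooth s).continuousAt
  refine ⟨c, contDiff_iff_contDiffAt.2 fun s => ?_, hc1, hc2⟩
  exact B.contDiffAt_lift (hmem s) (hcont s) (Filter.Eventually.of_forall hc2)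
    (hγ.isArclengthLoop.smooth s)

/-- The boundary curve of a disc `B` for a domain `Ω` which, near the boundary of `B`, lies inside
of `B` (`ε = 1`) or outside of `B` (`ε = -1`): compared with the parameter circle, its orientation
is `ε` times the sign `τ` of the parametrization. -/
theorem IsOrientedBoundaryCurve.integral_eq_sign (hX : IsSpacelikeOff X S)
    (hγ : IsOrientedBoundaryCurve X Ω B γ L) (hS : Disjoint B.bdry S) {τ ε : ℝ}
    (hτ : τ = 1 ∨ τ = -1) (hε : ε = 1 ∨ ε = -1)
    (hJ : ∀ z ∈ Metric.closedBall (0 : ℂ) 1, B.toFun z ∉ S → 0 < τ * signedJacobian X B.toFun z)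
    (hside : ∀ z : ℂ, ‖z‖ = 1 → ∀ᶠ y in 𝓝 z, ε * ‖y‖ ^ 2 < ε → B.toFun y ∈ Ω)
    {K : M → L3 →L[ℝ] L3} (hK : ∀ p ∉ S, ContMDiffAt (𝓡 2) 𝓘(ℝ, L3 →L[ℝ] L3) ∞ K p) :
    ∫ s in (0 : ℝ)..L, K (γ s) (diffl X (γ s) (velocity γ s)) =
      (ε * τ) • circleInt (pullForm X K B.toFun) := by
  obtain ⟨c, hc, h1, hbc⟩ := hγ.exists_lift
  obtain ⟨σ, hσ, hσκ, hint⟩ := hγ.integral_eq hX hc h1 hbc hS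
  rw [hint K hK]
  congr 1
  obtain ⟨w, k, hk0, hkd, hkout, hkJ⟩ := hγ.exists_outward hX hc h1 hbc hS 0
  have hmem : c 0 ∈ Metric.closedBall (0 : ℂ) 1 := by simp [h1 0]
  have hcS : B.toFun (c 0) ∉ S := Set.disjoint_left.1 hS ⟨c 0, by simp [h1 0], rfl⟩
  have hJ0 := hJ _ hmem hcS
  -- the conormal cannot point into the domain
  have hx : 0 ≤ ε * (w * (starRingEnd ℂ) (c 0)).re := by
    by_contra hneg
    have h2 := (hasDerivAt_normSq hkd).const_mul ε
    rw [hk0] at h2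
    have h3 := eventually_lt_of_hasDerivAt_neg h2 (by linarith)
    have h4 : ∀ᶠ t in 𝓝[>] (0 : ℝ), ε * ‖k t‖ ^ 2 < ε → B.toFun (k t) ∈ Ω := by
      have h5 := hkd.continuousAt.eventually (hk0.symm ▸ hside (c 0) (h1 0))
      exact h5.filter_mono nhdsWithin_le_nhds
    obtain ⟨t, ht1, ht2, ht3⟩ := (hkout.and (h3.and h4)).exists
    rw [hk0, h1] at ht2
    exact ht1 (ht3 (by simpa using ht2))
  have hκ := hσκ 0
  set J := signedJacobian X B.toFun (c 0)
  set κ := angularVelocity c 0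
  set x := (w * (starRingEnd ℂ) (c 0)).re
  -- `(τ J) (σ κ) (ε x) = σ ε τ`, and the factors on the left are nonnegative
  have h6 : 0 ≤ (τ * J) * (σ * κ) * (ε * x) := mul_nonneg (mul_pos hJ0 hκ).le hx
  have h7 : (τ * J) * (σ * κ) * (ε * x) = τ * σ * ε := by
    linear_combination (τ * σ * ε) * hkJ
  rw [h7] at h6
  rcases hσ with h | h <;> rcases hτ with h' | h' <;> rcases hε with h'' | h'' <;>
    rw [h, h', h''] at h6 ⊢ <;> first | (norm_num; done) | norm_num at h6

end Surface

/-! ### Balance of periods of closed forms -/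

section Surface

variable {M : Type*} [TopologicalSpace M] [ChartedSpace E2 M]
  {X : M → L3} {n : ℕ} {q : Fin n → M} {Binf : ClosedDisc M} {B : Fin n → ClosedDisc M}

theorem AreSeparatingDiscs.disjoint_bdry (hB : AreSeparatingDiscs q Binf B) (i : Fin n) :
    Disjoint (B i).bdry (Set.range q) := by
  rw [Set.disjoint_left]
  rintro p hp ⟨j, rfl⟩
  by_cases hj : j = i
  · subst hj
    exact Set.disjoint_left.1 (B j).disjoint_inner_bdry (hB.mem_inner j) hp
  · exact hB.notMem i j hj ((B i).bdry_subset_carrier hp)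

theorem AreSeparatingDiscs.mem_inner_infty (hB : AreSeparatingDiscs q Binf B) {p : M}
    (hp : p ∈ ⋃ i, (B i).inner) : p ∈ Binf.inner := by
  obtain ⟨i, hi⟩ := Set.mem_iUnion.1 hp
  exact hB.subset i ((B i).inner_subset_carrier hi)

theorem AreSeparatingDiscs.disjoint_bdry_infty (hB : AreSeparatingDiscs q Binf B) :
    Disjoint Binf.bdry (Set.range q) := by
  rw [Set.disjoint_left]
  rintro p hp ⟨j, rfl⟩
  exact Set.disjoint_left.1 Binf.disjoint_inner_bdry
    (hB.mem_inner_infty (Set.mem_iUnion.2 ⟨j, hB.mem_inner j⟩)) hp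

variable [T2Space M] [IsManifold (𝓡 2) ∞ M]

/-- A smooth function that is `1` near the singularities and supported in the inner discs. -/
theorem exists_cutoff (hB : AreSeparatingDiscs q Binf B) :
    ∃ ρ : M → ℝ, ContMDiff (𝓡 2) 𝓘(ℝ, ℝ) ∞ ρ ∧ (∀ i, ρ =ᶠ[𝓝 (q i)] 1) ∧
      ∀ p, p ∉ ⋃ i, (B i).inner → ρ =ᶠ[𝓝 p] 0 := by
  have h : ∀ i, ∃ f : SmoothBumpFunction (𝓡 2) (q i), tsupport f ⊆ (B i).inner := fun i => by
    obtain ⟨f, -, hf⟩ := (SmoothBumpFunction.nhds_basis_tsupport (I := 𝓡 2) (q i)).mem_iff.1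
      ((B i).isOpen_inner.mem_nhds (hB.mem_inner i))
    exact ⟨f, hf⟩
  choose f hf using h
  have hz : ∀ i p, p ∉ (B i).inner → f i =ᶠ[𝓝 p] 0 := fun i p hp =>
    notMem_tsupport_iff_eventuallyEq.1 fun h => hp (hf i h)
  refine ⟨fun p => ∑ i, f i p, ContMDiff.sum fun i _ => (f i).contMDiff, fun i => ?_,
    fun p hp => ?_⟩
  · have h1 : ∀ᶠ p in 𝓝 (q i), ∀ j, j ≠ i → f j p = 0 := by
      refine Filter.eventually_all.2 fun j => ?_
      by_cases hj : j = i
      · exact Filter.Eventually.of_forall fun p h => absurd hj h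
      · filter_upwards [hz j (q i) fun h => hB.notMem j i (Ne.symm hj)
          ((B j).inner_subset_carrier h)] with p hp _ using hp
    filter_upwards [h1, (f i).eventuallyEq_one] with p hp1 hp2
    rw [Finset.sum_eq_single i (fun j _ hj => hp1 j hj) (fun h => absurd (Finset.mem_univ i) h),
      hp2]
  · have h1 : ∀ᶠ p' in 𝓝 p, ∀ j, f j p' = 0 := Filter.eventually_all.2 fun j =>
      hz j p fun h => hp (Set.mem_iUnion.2 ⟨j, h⟩)
    filter_upwards [h1] with p' hp'
    simp [hp']

/-- Stokes' theorem on a disc of the surface, for a closed form cut off at the singularities. -/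
theorem circleInt_pullForm (hX : IsSpacelikeOff X (Set.range q)) {K : M → L3 →L[ℝ] L3}
    (hK : ∀ p ∉ Set.range q, ContMDiffAt (𝓡 2) 𝓘(ℝ, L3 →L[ℝ] L3) ∞ K p)
    (hcl : ∀ p ∉ Set.range q, ClosedFormAt X K p) {ρ : M → ℝ}
    (hρ : ContMDiff (𝓡 2) 𝓘(ℝ, ℝ) ∞ ρ) (hρ1 : ∀ i, ρ =ᶠ[𝓝 (q i)] 1) (D : ClosedDisc M)
    (hρ0 : ∀ p ∈ D.bdry, ρ p = 0) :
    circleInt (pullForm X K D.toFun) =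
      -∫ z in Metric.ball (0 : ℂ) 1, dWedge (ρ ∘ D.toFun) (pullForm X K D.toFun) z := by
  obtain ⟨U, hU, hBU, hD⟩ := D.smooth
  have hDU : ∀ z ∈ U, ContMDiffAt 𝓘(ℝ, ℂ) (𝓡 2) ∞ D.toFun z := fun z hz =>
    hD.contMDiffAt (hU.mem_nhds hz)
  refine circleInt_eq_neg_integral_dWedge hU hBU (fun z hz => ?_) (fun z hz => ?_) fun z hz => ?_
  · exact (((hρ _).comp z (hDU z hz)).contDiffAt.of_le (by simp)).contDiffWithinAt
  · by_cases hS : D.toFun z ∈ Set.range q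
    · right
      obtain ⟨i, hi⟩ := hS
      exact (hDU z hz).continuousAt.eventually (hi ▸ hρ1 i)
    · left
      refine ⟨(contDiffAt_pullForm (hX.smooth _ hS) (hK _ hS) (hDU z hz)).of_le (by simp),
        fun u v => ?_⟩
      refine fderiv_pullForm_symm (hX.eventually hS hX.smooth) (hK _ hS) ?_ (hcl _ hS) u v
      filter_upwards [hU.mem_nhds hz] with w hw using hDU w hw
  · exact hρ0 _ ⟨z, by simpa using hz, rfl⟩

/-- The contribution of an inner disc to the integral over the outer disc. -/
theorem integral_dWedge_inner (hX : IsSpacelikeOff X (Set.range q)) (K : M → L3 →L[ℝ] L3)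
    {ρ : M → ℝ} (hρ : ContMDiff (𝓡 2) 𝓘(ℝ, ℝ) ∞ ρ) (hρ1 : ∀ i, ρ =ᶠ[𝓝 (q i)] 1)
    {D D' : ClosedDisc M} (hsub : D'.carrier ⊆ D.inner) {τ τ' : ℝ} (hτ : τ = 1 ∨ τ = -1)
    (hτ' : τ' = 1 ∨ τ' = -1)
    (hJ : ∀ z ∈ Metric.closedBall (0 : ℂ) 1, D.toFun z ∉ Set.range q →
      0 < τ * signedJacobian X D.toFun z)
    (hJ' : ∀ z ∈ Metric.closedBall (0 : ℂ) 1, D'.toFun z ∉ Set.range q →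
      0 < τ' * signedJacobian X D'.toFun z) :
    ∫ z in Metric.ball (0 : ℂ) 1 ∩ D.toFun ⁻¹' D'.inner,
        dWedge (ρ ∘ D.toFun) (pullForm X K D.toFun) z =
      (τ * τ') • ∫ z in Metric.ball (0 : ℂ) 1,
        dWedge (ρ ∘ D'.toFun) (pullForm X K D'.toFun) z := by
  classical
  have hex : ∀ z : ℂ, ∃ w : ℂ, z ∈ Metric.closedBall (0 : ℂ) 1 →
      w ∈ Metric.ball (0 : ℂ) 1 ∧ D.toFun w = D'.toFun z := by
    intro z
    by_cases hz : z ∈ Metric.closedBall (0 : ℂ) 1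
    · obtain ⟨w, hw, h⟩ := hsub ⟨z, hz, rfl⟩
      exact ⟨w, fun _ => ⟨hw, h⟩⟩
    · exact ⟨0, fun h => absurd h hz⟩
  -- `φ` is the transition map from the inner to the outer disc
  choose φ hφ using hex
  have hcb : ∀ z ∈ Metric.ball (0 : ℂ) 1, z ∈ Metric.closedBall (0 : ℂ) 1 := fun z hz =>
    Metric.ball_subset_closedBall hz
  have hφev : ∀ z ∈ Metric.ball (0 : ℂ) 1, ∀ᶠ y in 𝓝 z, φ y ∈ Metric.ball (0 : ℂ) 1 ∧
      D.toFun (φ y) = D'.toFun y := fun z hz => by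
    filter_upwards [Metric.isOpen_ball.mem_nhds hz] with y hy using hφ y (hcb y hy)
  have hφs : ∀ z ∈ Metric.ball (0 : ℂ) 1, ContDiffAt ℝ ∞ φ z := by
    intro z hz
    have hmem := hcb _ (hφ z (hcb z hz)).1
    refine D.contDiffAt_lift hmem ?_ ((hφev z hz).mono fun y hy => hy.2) (D'.contMDiffAt (hcb z hz))
    refine D.tendsto_lift hmem ((hφev z hz).mono fun y hy => hcb _ hy.1) ?_
    rw [(hφ z (hcb z hz)).2]
    exact ((D'.contMDiffAt (hcb z hz)).continuousAt.tendsto).congr'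
      ((hφev z hz).mono fun y hy => hy.2.symm)
  have himg : φ '' Metric.ball 0 1 = Metric.ball (0 : ℂ) 1 ∩ D.toFun ⁻¹' D'.inner := by
    ext w
    constructor
    · rintro ⟨z, hz, rfl⟩
      exact ⟨(hφ z (hcb z hz)).1, z, hz, (hφ z (hcb z hz)).2.symm⟩
    · rintro ⟨hw, z, hz, h⟩
      refine ⟨z, hz, D.injOn (hcb _ (hφ z (hcb z hz)).1) (hcb w hw) ?_⟩
      rw [(hφ z (hcb z hz)).2, h]
  rw [← himg]
  refine integral_dWedge_image Metric.isOpen_ball.measurableSet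
    (fun z hz => ((hφs z hz).differentiableAt (by simp)).hasFDerivAt) ?_ fun z hz => ⟨?_, ?_⟩
  · intro z hz w hw h
    refine D'.injOn (hcb z hz) (hcb w hw) ?_
    rw [← (hφ z (hcb z hz)).2, ← (hφ w (hcb w hw)).2, h]
  · have e : ρ ∘ D'.toFun =ᶠ[𝓝 z] (ρ ∘ D.toFun) ∘ φ := by
      filter_upwards [hφev z hz] with y hy
      simp [hy.2]
    rw [e.fderiv_eq, fderiv_comp]
    · exact ((hρ _).comp _ (D.contMDiffAt (hcb _ (hφ z (hcb z hz)).1))).contDiffAt.differentiableAt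
        (by simp)
    · exact (hφs z hz).differentiableAt (by simp)
  · obtain ⟨h1, h2⟩ := hφ z (hcb z hz)
    have h1' := hcb _ h1
    by_cases hS : D.toFun (φ z) ∈ Set.range q
    · left
      obtain ⟨i, hi⟩ := hS
      have e1 : ρ =ᶠ[𝓝 (D.toFun (φ z))] fun _ => 1 := hi ▸ hρ1 i
      have e : ρ ∘ D.toFun =ᶠ[𝓝 (φ z)] fun _ => 1 :=
        (D.contMDiffAt h1').continuousAt.eventually e1
      rw [e.fderiv_eq]
      exact fderiv_const_apply 1
    · right
      have e : D'.toFun =ᶠ[𝓝 z] D.toFun ∘ φ := (hφev z hz).mono fun y hy => hy.2.symm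
      have hY : DifferentiableAt ℝ (X ∘ D.toFun) (φ z) :=
        ((hX.smooth _ hS).comp _ (D.contMDiffAt h1')).contDiffAt.differentiableAt (by simp)
      have hφd := (hφs z hz).differentiableAt (by simp)
      constructor
      · have e' : X ∘ D'.toFun =ᶠ[𝓝 z] (X ∘ D.toFun) ∘ φ := e.fun_comp X
        rw [pullForm, pullForm, e'.fderiv_eq, fderiv_comp _ hY hφd, h2]
        rfl
      -- `det φ'` is the quotient of the two area densities, hence has the sign `τ τ'`
      · have hj := signedJacobian_comp (X := X) e hφd hY
        have p1 := hJ _ h1' hS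
        have p2 := hJ' z (hcb z hz) (h2 ▸ hS)
        rw [hj] at p2
        have p3 : 0 < τ * τ' * (fderiv ℝ φ z).det := by
          have := mul_pos p1 p2
          have e3 : τ * signedJacobian X D.toFun (φ z) *
              (τ' * ((fderiv ℝ φ z).det * signedJacobian X D.toFun (φ z))) =
              τ * τ' * (fderiv ℝ φ z).det * signedJacobian X D.toFun (φ z) ^ 2 := by ring
          rw [e3] at this
          exact pos_of_mul_pos_left this (sq_nonneg _)
        have hτ2 : |τ * τ'| = 1 := by
          rcases hτ with h | h <;> rcases hτ' with h' | h' <;> rw [h, h'] <;> norm_num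
        rw [← abs_of_pos p3, abs_mul, hτ2, one_mul]

/-- For a closed form, the integral over the boundary circle of the outer disc is the sum of the
integrals over those of the inner discs, each one with the sign of its parametrization. -/
theorem circleInt_balance (hX : IsSpacelikeOff X (Set.range q)) {K : M → L3 →L[ℝ] L3}
    (hK : ∀ p ∉ Set.range q, ContMDiffAt (𝓡 2) 𝓘(ℝ, L3 →L[ℝ] L3) ∞ K p)
    (hcl : ∀ p ∉ Set.range q, ClosedFormAt X K p) (hB : AreSeparatingDiscs q Binf B)
    {τ : ℝ} {τ' : Fin n → ℝ} (hτ : τ = 1 ∨ τ = -1) (hτ' : ∀ i, τ' i = 1 ∨ τ' i = -1)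
    (hJ : ∀ z ∈ Metric.closedBall (0 : ℂ) 1, Binf.toFun z ∉ Set.range q →
      0 < τ * signedJacobian X Binf.toFun z)
    (hJ' : ∀ i, ∀ z ∈ Metric.closedBall (0 : ℂ) 1, (B i).toFun z ∉ Set.range q →
      0 < τ' i * signedJacobian X (B i).toFun z) :
    τ • circleInt (pullForm X K Binf.toFun) =
      ∑ i, τ' i • circleInt (pullForm X K (B i).toFun) := by
  obtain ⟨ρ, hρ, hρ1, hρ0⟩ := exists_cutoff hB
  have hinf := circleInt_pullForm hX hK hcl hρ hρ1 Binf fun p hp => (hρ0 p fun h =>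
    Set.disjoint_left.1 Binf.disjoint_inner_bdry (hB.mem_inner_infty h) hp).self_of_nhds
  have hin : ∀ i, _ := fun i => circleInt_pullForm hX hK hcl hρ hρ1 (B i) fun p hp =>
    (hρ0 p fun h => by
      obtain ⟨j, hj⟩ := Set.mem_iUnion.1 h
      by_cases hij : j = i
      · subst hij
        exact Set.disjoint_left.1 (B j).disjoint_inner_bdry hj hp
      · exact Set.disjoint_left.1 (hB.disjoint j i hij) ((B j).inner_subset_carrier hj)
          ((B i).bdry_subset_carrier hp)).self_of_nhds
  set V : Fin n → Set ℂ := fun i => Metric.ball (0 : ℂ) 1 ∩ Binf.toFun ⁻¹' (B i).inner with hV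
  set θ : ℂ → L3 := dWedge (ρ ∘ Binf.toFun) (pullForm X K Binf.toFun) with hθ
  have hfc : ContinuousOn Binf.toFun (Metric.ball 0 1) :=
    Binf.continuousOn.mono Metric.ball_subset_closedBall
  have hVm : ∀ i, MeasurableSet (V i) := fun i =>
    (hfc.isOpen_inter_preimage Metric.isOpen_ball (B i).isOpen_inner).measurableSet
  have hconst : ∀ z ∈ Metric.closedBall (0 : ℂ) 1, ∀ a : ℝ,
      ρ =ᶠ[𝓝 (Binf.toFun z)] (fun _ => a) → θ =ᶠ[𝓝 z] 0 := by
    intro z hz a h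
    have h1 : ρ ∘ Binf.toFun =ᶠ[𝓝 z] fun _ => a :=
      (Binf.contMDiffAt hz).continuousAt.eventually h
    filter_upwards [h1.eventually_nhds] with y hy
    have h2 : fderiv ℝ (ρ ∘ Binf.toFun) y = 0 := by
      rw [Filter.EventuallyEq.fderiv_eq hy]
      exact fderiv_const_apply a
    simp [hθ, dWedge, h2]
  -- at a singularity `θ` vanishes identically nearby, as `ρ` is constant there
  have hθc : ContinuousOn θ (Metric.closedBall 0 1) := by
    intro z hz
    refine ContinuousAt.continuousWithinAt ?_
    by_cases hS : Binf.toFun z ∈ Set.range q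
    · obtain ⟨i, hi⟩ := hS
      have e1 : ρ =ᶠ[𝓝 (Binf.toFun z)] fun _ => 1 := hi ▸ hρ1 i
      exact (continuousAt_const : ContinuousAt (fun _ => (0 : L3)) z).congr (hconst z hz 1 e1).symm
    · have h1 : ContinuousAt (fderiv ℝ (ρ ∘ Binf.toFun)) z :=
        (((hρ _).comp z (Binf.contMDiffAt hz)).contDiffAt.fderiv_right (m := 0)
          (by simp)).continuousAt
      have h2 : ContinuousAt (pullForm X K Binf.toFun) z :=
        (contDiffAt_pullForm (hX.smooth _ hS) (hK _ hS) (Binf.contMDiffAt hz)).continuousAt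
      exact ((h1.clm_apply continuousAt_const).smul (h2.clm_apply continuousAt_const)).sub
        ((h1.clm_apply continuousAt_const).smul (h2.clm_apply continuousAt_const))
  have hθi : MeasureTheory.IntegrableOn θ (Metric.closedBall 0 1) :=
    hθc.integrableOn_compact (isCompact_closedBall 0 1)
  have hsum : ∫ z in Metric.ball (0 : ℂ) 1, θ z = ∑ i, ∫ z in V i, θ z := by
    rw [← MeasureTheory.integral_iUnion_fintype hVm]
    · refine MeasureTheory.setIntegral_eq_of_subset_of_forall_sdiff_eq_zero
        Metric.isOpen_ball.measurableSet (Set.iUnion_subset fun i => Set.inter_subset_left) ?_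
      rintro z ⟨hz, hzV⟩
      refine (hconst z (Metric.ball_subset_closedBall hz) 0 (hρ0 _ fun h => hzV ?_)).self_of_nhds
      obtain ⟨i, hi⟩ := Set.mem_iUnion.1 h
      exact Set.mem_iUnion.2 ⟨i, hz, hi⟩
    · intro i j hij
      rw [Function.onFun, Set.disjoint_left]
      rintro z ⟨-, h1⟩ ⟨-, h2⟩
      exact Set.disjoint_left.1 (hB.disjoint i j hij) ((B i).inner_subset_carrier h1)
        ((B j).inner_subset_carrier h2)
    · exact fun i => hθi.mono_set
        (Set.inter_subset_left.trans Metric.ball_subset_closedBall)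
  have hτ2 : τ * τ = 1 := by rcases hτ with h | h <;> rw [h] <;> norm_num
  rw [hinf, hsum, smul_neg, Finset.smul_sum, ← Finset.sum_neg_distrib]
  refine Finset.sum_congr rfl fun i _ => ?_
  rw [hin i, integral_dWedge_inner hX K hρ hρ1 (hB.subset i) hτ (hτ' i) hJ (hJ' i), smul_smul,
    ← mul_assoc, hτ2, one_mul, smul_neg]

/-- The integrals of a closed form over the oriented boundary curves of the domain add up to
zero. -/
theorem integral_balance (hX : IsSpacelikeOff X (Set.range q)) {K : M → L3 →L[ℝ] L3}
    (hK : ∀ p ∉ Set.range q, ContMDiffAt (𝓡 2) 𝓘(ℝ, L3 →L[ℝ] L3) ∞ K p)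
    (hcl : ∀ p ∉ Set.range q, ClosedFormAt X K p) (hB : AreSeparatingDiscs q Binf B)
    {γinf : ℝ → M} {Linf : ℝ} {γ : Fin n → ℝ → M} {L : Fin n → ℝ}
    (hγinf : IsOrientedBoundaryCurve X (holedDisc Binf B) Binf γinf Linf)
    (hγ : ∀ i, IsOrientedBoundaryCurve X (holedDisc Binf B) (B i) (γ i) (L i)) :
    (∫ s in (0 : ℝ)..Linf, K (γinf s) (diffl X (γinf s) (velocity γinf s))) +
      ∑ i, ∫ s in (0 : ℝ)..L i, K (γ i s) (diffl X (γ i s) (velocity (γ i) s)) = 0 := by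
  obtain ⟨τ, hτ, hJ⟩ := ClosedDisc.exists_sign_signedJacobian hX Binf
  have h := fun i => ClosedDisc.exists_sign_signedJacobian hX (B i)
  choose τ' hτ' hJ' using h
  have hcarr : ∀ i, IsClosed (B i).carrier := fun i => (B i).isCompact_carrier.isClosed
  have e1 := hγinf.integral_eq_sign hX hB.disjoint_bdry_infty hτ (Or.inl rfl : (1 : ℝ) = 1 ∨ _) hJ
    (fun z hz => by
      have hzm : z ∈ Metric.closedBall (0 : ℂ) 1 := by simp [hz]
      have hout : Binf.toFun z ∈ (⋃ i, (B i).carrier)ᶜ := by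
        intro h
        obtain ⟨i, hi⟩ := Set.mem_iUnion.1 h
        exact Set.disjoint_left.1 Binf.disjoint_inner_bdry (hB.subset i hi) ⟨z, by simp [hz], rfl⟩
      filter_upwards [(Binf.contMDiffAt hzm).continuousAt.eventually
        ((isClosed_iUnion_of_finite hcarr).isOpen_compl.mem_nhds hout)] with y hy hlt
      refine ⟨⟨y, ?_, rfl⟩, fun h => hy ?_⟩
      · have : ‖y‖ < 1 := by nlinarith [norm_nonneg y]
        simpa using this.le
      · obtain ⟨i, hi⟩ := Set.mem_iUnion.1 h
        exact Set.mem_iUnion.2 ⟨i, (B i).inner_subset_carrier hi⟩) hK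
  have e2 : ∀ i, _ := fun i => (hγ i).integral_eq_sign hX (hB.disjoint_bdry i) (hτ' i)
    (Or.inr rfl : (-1 : ℝ) = 1 ∨ _) (hJ' i)
    (fun z hz => by
      have hzm : z ∈ Metric.closedBall (0 : ℂ) 1 := by simp [hz]
      have hzb : (B i).toFun z ∈ (B i).carrier := ⟨z, hzm, rfl⟩
      have hout : ∀ᶠ p in 𝓝 ((B i).toFun z), ∀ j, j ≠ i → p ∉ (B j).carrier := by
        refine Filter.eventually_all.2 fun j => ?_
        by_cases hj : j = i
        · exact Filter.Eventually.of_forall fun p h => absurd hj h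
        · filter_upwards [(hcarr j).isOpen_compl.mem_nhds
            (Set.disjoint_left.1 (hB.disjoint i j (Ne.symm hj)) hzb)] with p hp _ using hp
      have hc := ((B i).contMDiffAt hzm).continuousAt
      filter_upwards [hc.eventually hout,
        hc.eventually (Binf.isOpen_inner.mem_nhds (hB.subset i hzb)),
        (B i).eventually_mem_closedBall hzm] with y h1 h2 h3 hlt
      refine ⟨Binf.inner_subset_carrier h2, fun h => ?_⟩
      obtain ⟨j, hj⟩ := Set.mem_iUnion.1 h
      by_cases hij : j = i
      · subst hij
        have := h3 ((B j).inner_subset_carrier hj)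
        have hy : ‖y‖ ≤ 1 := by simpa using this
        nlinarith [norm_nonneg y]
      · exact h1 j hij ((B j).inner_subset_carrier hj)) hK
  rw [e1, Finset.sum_congr rfl fun i _ => e2 i, one_mul,
    circleInt_balance hX hK hcl hB hτ hτ' hJ hJ', ← Finset.sum_add_distrib]
  refine Finset.sum_eq_zero fun i _ => ?_
  rw [neg_one_mul, neg_smul, add_neg_cancel]

end Surface

end MaximalSurface

end

theorem proposition2p2 {M : Type*} [TopologicalSpace M] [T2Space M] [SecondCountableTopology M]
    [ConnectedSpace M] [ChartedSpace MaximalSurface.E2 M] [IsManifold (𝓡 2) ∞ M]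
    (X : M → MaximalSurface.L3) {n : ℕ} (q : Fin n → M) (hq : Function.Injective q)
    (hX : MaximalSurface.IsCMFGraph X (Set.range q))
    (Binf : MaximalSurface.ClosedDisc M) (B : Fin n → MaximalSurface.ClosedDisc M)
    (hB : MaximalSurface.AreSeparatingDiscs q Binf B)
    (γinf : ℝ → M) (Linf : ℝ) (γ : Fin n → ℝ → M) (L : Fin n → ℝ)
    (hγinf : MaximalSurface.IsOrientedBoundaryCurve X (MaximalSurface.holedDisc Binf B)
      Binf γinf Linf)
    (hγ : ∀ i, MaximalSurface.IsOrientedBoundaryCurve X (MaximalSurface.holedDisc Binf B)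
      (B i) (γ i) (L i)) :
    MaximalSurface.flux X γinf Linf + ∑ i, MaximalSurface.flux X (γ i) (L i) = 0 ∧
    MaximalSurface.torque X γinf Linf + ∑ i, MaximalSurface.torque X (γ i) (L i) = 0 := by
  have hopen : IsOpen (Set.range q)ᶜ := hX.finite.isClosed.isOpen_compl
  have hS : MaximalSurface.IsSpacelikeOff X (Set.range q) :=
    { finite := hX.finite
      smooth := fun p hp => hX.isMaximalImmersionOn.smooth.contMDiffAt (hopen.mem_nhds hp)
      spacelike := fun p hp => hX.isMaximalImmersionOn.spacelike p hp }
  exact ⟨MaximalSurface.integral_balance hS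
      (fun p hp => MaximalSurface.contMDiffAt_fluxField (hS.eventually hp hS.smooth)
        (hS.eventually hp hS.spacelike))
      (fun p hp => MaximalSurface.closedFormAt_fluxField (hS.eventually hp hS.smooth)
        (hS.eventually hp hS.spacelike) (hX.isMaximalImmersionOn.maximal p hp)) hB hγinf hγ,
    MaximalSurface.integral_balance hS
      (fun p hp => MaximalSurface.contMDiffAt_torqueField (hS.eventually hp hS.smooth)
        (hS.eventually hp hS.spacelike))
      (fun p hp => MaximalSurface.closedFormAt_torqueField (hS.eventually hp hS.smooth)
        (hS.eventually hp hS.spacelike) (hX.isMaximalImmersionOn.maximal p hp)) hB hγinf hγ⟩
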